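/- Let $N\ge 1$, let $\Omega\subseteq\mathbb{R}^N$ be a bounded domain with Lipschitz boundary, and let $1<q<p<\infty$. Put $p^*=\frac{Np}{N-p}$ if $p<N$ and $p^*=+\infty$ if $N\le p$. $H(a)$: $a\in L^\infty(\Omega)$ and $a(z)>0$ for a.a. $z\in\Omega$. $H(f)$: $f:\Omega\times\mathbb{R}\to\mathbb{R}$ is a measurable function such that for a.a. $z\in\Omega$, $f(z,0)=0$, $f(z,\cdot)\in C^1(\mathbb{R}\setminus\{0\})$, and, with $F(z,x)=\int_0^x f(z,s)\,ds$: (i) $|f'_x(z,x)|\le a_0(z)(1+|x|^{r-2})$ for a.a. $z\in\Omega$ and all $x\ne 0$, with $a_0\in L^\infty(\Omega)$ and $p<r<p^*$; moreover there are $c>0$ and a real $s\le p^*$ with $f(z,x)x\le c(1+|x|^s)$ for a.a. $z\in\Omega$ and all $x\in\mathbb{R}$ (the latter is automatic, with $s=\max\{r,2\}$, if $r\ge 2$ or $p^*\ge 2$); (ii) $\lim_{x\to\pm\infty}\frac{F(z,x)}{|x|^p}=+\infty$ uniformly for a.a. $z\in\Omega$, and there exist $\tau\in\left(\max\{1,(r-p)\frac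 Np\},p^*\right)$ and $\beta_0>0$ such that $\beta_0\le\liminf_{x\to\pm\infty}\frac{f(z,x)x-pF(z,x)}{|x|^\tau}$ uniformly for a.a. $z\in\Omega$; (iii) $\lim_{x\to 0}\frac{f(z,x)}{|x|^{q-2}x}=0$ uniformly for a.a. $z\in\Omega$; (iv) $0<(p-1)f(z,x)x\le f'_x(z,x)x^2$ for a.a. $z\in\Omega$ and all $x\ne 0$. Define the energy functional $\varphi:W^{1,p}_0(\Omega)\to\mathbb{R}$ by $$\varphi(u)=\frac1p\|Du\|_p^p+\frac1q\int_\Omega a(z)|Du|^q\,dz-\int_\Omega F(z,u)\,dz,$$ and the Nehari manifold $\mathcal{N}=\{u\in W^{1,p}_0(\Omega):\langle\varphi'(u),u\rangle=0,\ u\ne 0\}$, where $\varphi'$ is the Fréchet derivative of $\varphi$. If $H(a)$ and $H(f)$ hold, then $m=\inf_{\mathcal{N}}\varphi>0$ (the infimum being over a nonempty set and finite). -/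

import Mathlib

open MeasureTheory Set
open scoped ENNReal NNReal ContDiff

noncomputable section

/-- The Euclidean space `ℝ^N`. -/
abbrev Eucl (N : ℕ) : Type := EuclideanSpace ℝ (Fin N)

/-- Lipschitz boundary: near each boundary point, `Ω` is the strict epigraph, in some unit direction
`e`, of a Lipschitz function of the coordinates orthogonal to `e` (that is, of a Lipschitz function
`g` on `ℝ^N` which is invariant under translations along `e`). -/
def HasLipschitzBoundary {N : ℕ} (Ω : Set (Eucl N)) : Prop :=
  ∀ x ∈ frontier Ω, ∃ ρ > 0, ∃ e : Eucl N, ‖e‖ = 1 ∧ ∃ (K : ℝ≥0) (g : Eucl N → ℝ),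
    LipschitzWith K g ∧ (∀ (y : Eucl N) (t : ℝ), g (y + t • e) = g y) ∧
    Ω ∩ Metric.ball x ρ = {y | g y < inner ℝ e y} ∩ Metric.ball x ρ

/-- A bounded domain (nonempty connected open bounded set) with Lipschitz boundary. -/
structure IsLipschitzDomain {N : ℕ} (Ω : Set (Eucl N)) : Prop where
  isOpen : IsOpen Ω
  isConnected : IsConnected Ω
  isBounded : Bornology.IsBounded Ω
  lipschitz : HasLipschitzBoundary Ω

/-- `φ ∈ C_c^∞(Ω)`. -/
structure IsTestFunction {N : ℕ} (Ω : Set (Eucl N)) (φ : Eucl N → ℝ) : Prop where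
  smooth : ContDiff ℝ ∞ φ
  compactSupport : HasCompactSupport φ
  support_subset : tsupport φ ⊆ Ω

/-- The space `L^p(Ω) × L^p(Ω; ℝ^N)`, in which `W^{1,p}(Ω)` sits through `u ↦ (u, Du)`. -/
abbrev LpPair {N : ℕ} (Ω : Set (Eucl N)) (p : ℝ) : Type :=
  Lp ℝ (ENNReal.ofReal p) (volume.restrict Ω) × Lp (Eucl N) (ENNReal.ofReal p) (volume.restrict Ω)

/-- The pairs `(φ, ∇φ)`, with `φ ∈ C_c^∞(Ω)`. -/
def testPairs {N : ℕ} (Ω : Set (Eucl N)) (p : ℝ) : Submodule ℝ (LpPair Ω p) where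
  carrier := {w | ∃ φ : Eucl N → ℝ, IsTestFunction Ω φ ∧
    (∀ᵐ z ∂(volume.restrict Ω), w.1 z = φ z) ∧
    (∀ᵐ z ∂(volume.restrict Ω), w.2 z = gradient φ z)}
  zero_mem' := by
    refine ⟨fun _ => 0, ⟨contDiff_const, HasCompactSupport.zero, by simp [tsupport]⟩, ?_, ?_⟩
    · filter_upwards [Lp.coeFn_zero ℝ (ENNReal.ofReal p) (volume.restrict Ω)] with z hz
      simpa using hz
    · filter_upwards [Lp.coeFn_zero (Eucl N) (ENNReal.ofReal p) (volume.restrict Ω)] with z hz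
      simpa [gradient] using hz
  add_mem' := by
    rintro v w ⟨φ, hφ, h1, h2⟩ ⟨ψ, hψ, h3, h4⟩
    refine ⟨φ + ψ, ⟨hφ.smooth.add hψ.smooth, hφ.compactSupport.add hψ.compactSupport,
      (tsupport_add φ ψ).trans (union_subset hφ.support_subset hψ.support_subset)⟩, ?_, ?_⟩
    · filter_upwards [h1, h3, Lp.coeFn_add v.1 w.1] with z a b c
      simpa [a, b] using c
    · filter_upwards [h2, h4, Lp.coeFn_add v.2 w.2] with z a b c
      have e1 := (hφ.smooth.differentiable (by simp)) z
      have e2 := (hψ.smooth.differentiable (by simp)) z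
      have : gradient (φ + ψ) z = gradient φ z + gradient ψ z := by
        simp [gradient, fderiv_add e1 e2]
      rw [this, ← a, ← b]
      exact c
  smul_mem' := by
    rintro t w ⟨φ, hφ, h1, h2⟩
    refine ⟨t • φ, ⟨contDiff_const.smul hφ.smooth, hφ.compactSupport.smul_left (f := fun _ => t),
      (tsupport_smul_subset_right (fun _ => t) φ).trans hφ.support_subset⟩, ?_, ?_⟩
    · filter_upwards [h1, Lp.coeFn_smul t w.1] with z a c
      simpa [a] using c
    · filter_upwards [h2, Lp.coeFn_smul t w.2] with z a c
      have e1 := (hφ.smooth.differentiable (by simp)) z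
      have : gradient (t • φ) z = t • gradient φ z := by
        simp [gradient, fderiv_const_smul e1 t]
      rw [this, ← a]
      exact c

/-- The Sobolev space `W^{1,p}_0(Ω)`, the closure of `C_c^∞(Ω)` in `W^{1,p}(Ω)`. A function `u` is
represented by the pair `(u, Du)` of the function and its weak gradient, and the norm is
`max (‖u‖_p, ‖Du‖_p)`, which is equivalent to `‖Du‖_p` on a bounded domain. -/
abbrev W0 {N : ℕ} (Ω : Set (Eucl N)) (p : ℝ) [Fact (1 ≤ ENNReal.ofReal p)] : Type :=
  (testPairs Ω p).topologicalClosure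

/-- The weak gradient `Du` of `u ∈ W^{1,p}_0(Ω)`. -/
def W0.grad {N : ℕ} {Ω : Set (Eucl N)} {p : ℝ} [Fact (1 ≤ ENNReal.ofReal p)] (u : W0 Ω p) :
    Lp (Eucl N) (ENNReal.ofReal p) (volume.restrict Ω) := u.1.2

/-- The function in `L^p(Ω)` underlying `u ∈ W^{1,p}_0(Ω)`. -/
def W0.fn {N : ℕ} {Ω : Set (Eucl N)} {p : ℝ} [Fact (1 ≤ ENNReal.ofReal p)] (u : W0 Ω p) :
    Lp ℝ (ENNReal.ofReal p) (volume.restrict Ω) := u.1.1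

/-- The critical Sobolev exponent `p^*`: `Np/(N-p)` if `p < N`, and `+∞` otherwise. -/
def criticalExponent (N : ℕ) (p : ℝ) : EReal :=
  open Classical in if p < N then ((N * p / (N - p) : ℝ) : EReal) else ⊤

/-- The primitive `F(z,x) = ∫_0^x f(z,s) ds`. -/
def primitiveF {N : ℕ} (f : Eucl N → ℝ → ℝ) (z : Eucl N) (x : ℝ) : ℝ := ∫ s in (0 : ℝ)..x, f z s

/-- The hypotheses on the weight: `a ∈ L^∞(Ω)` and `a > 0` almost everywhere in `Ω`. -/
structure WeightHyp {N : ℕ} (Ω : Set (Eucl N)) (a : Eucl N → ℝ) : Prop where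
  memLp : MemLp a ∞ (volume.restrict Ω)
  pos : ∀ᵐ z ∂(volume.restrict Ω), 0 < a z

/-- The hypotheses on the reaction `f(z,x)`, with exponents `p`, `q`, `r`. -/
structure ReactionHyp {N : ℕ} (Ω : Set (Eucl N)) (p q r : ℝ) (f : Eucl N → ℝ → ℝ) : Prop where
  /-- `f` is (Lebesgue) measurable on `Ω × ℝ`. -/
  measurable : AEMeasurable (fun w : Eucl N × ℝ => f w.1 w.2) ((volume.restrict Ω).prod volume)
  zero : ∀ᵐ z ∂(volume.restrict Ω), f z 0 = 0
  contDiff : ∀ᵐ z ∂(volume.restrict Ω), ContDiffOn ℝ 1 (f z) {0}ᶜ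
  /-- The exponent `r` lies strictly between `p` and `p^*`. -/
  p_lt_r : p < r
  r_lt : (r : EReal) < criticalExponent N p
  /-- Growth of the derivative. -/
  deriv_bound : ∃ a₀ : Eucl N → ℝ, MemLp a₀ ∞ (volume.restrict Ω) ∧
    ∀ᵐ z ∂(volume.restrict Ω), ∀ x : ℝ, x ≠ 0 → |deriv (f z) x| ≤ a₀ z * (1 + |x| ^ (r - 2))
  /-- The growth of `f` is not supercritical. If `2 ≤ r` or `2 ≤ p^*`, this follows from
  `deriv_bound` and the other conditions, with `s = max r 2`; it is a restriction only if `r < 2`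
  and `p^* < 2`, where `deriv_bound` alone would admit `f(z,x) = x`, for which the energy is not
  finite on `W^{1,p}_0(Ω)`. -/
  growth : ∃ s c : ℝ, (s : EReal) ≤ criticalExponent N p ∧
    ∀ᵐ z ∂(volume.restrict Ω), ∀ x : ℝ, f z x * x ≤ c * (1 + |x| ^ s)
  /-- `F(z,x)/|x|^p → +∞` as `x → ±∞`, uniformly for a.a. `z`. -/
  superlinear : ∀ M : ℝ, ∃ R > 0, ∀ᵐ z ∂(volume.restrict Ω), ∀ x : ℝ, R ≤ |x| →
    M ≤ primitiveF f z x / |x| ^ p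
  /-- `liminf (f(z,x)x - pF(z,x))/|x|^τ ≥ β₀` as `x → ±∞`, uniformly for a.a. `z`. -/
  liminf_bound : ∃ τ β₀ : ℝ, max 1 ((r - p) * (N / p)) < τ ∧ (τ : EReal) < criticalExponent N p ∧
    0 < β₀ ∧ ∀ ε > 0, ∃ R > 0, ∀ᵐ z ∂(volume.restrict Ω), ∀ x : ℝ, R ≤ |x| →
      β₀ - ε ≤ (f z x * x - p * primitiveF f z x) / |x| ^ τ
  /-- `f(z,x)/(|x|^{q-2}x) → 0` as `x → 0`, uniformly for a.a. `z`. -/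
  limit_zero : ∀ ε > 0, ∃ δ > 0, ∀ᵐ z ∂(volume.restrict Ω), ∀ x : ℝ, 0 < |x| → |x| < δ →
    |f z x / (|x| ^ (q - 2) * x)| < ε
  monotone : ∀ᵐ z ∂(volume.restrict Ω), ∀ x : ℝ, x ≠ 0 →
    0 < (p - 1) * (f z x * x) ∧ (p - 1) * (f z x * x) ≤ deriv (f z) x * x ^ 2

/-- The energy functional
`φ(u) = (1/p) ‖Du‖_p^p + (1/q) ∫_Ω a |Du|^q dz - ∫_Ω F(z,u) dz` on `W^{1,p}_0(Ω)`. -/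
def energy {N : ℕ} (Ω : Set (Eucl N)) (p q : ℝ) [Fact (1 ≤ ENNReal.ofReal p)]
    (a : Eucl N → ℝ) (f : Eucl N → ℝ → ℝ) (u : W0 Ω p) : ℝ :=
  (1 / p) * ‖u.grad‖ ^ p + (1 / q) * (∫ z in Ω, a z * ‖u.grad z‖ ^ q)
    - ∫ z in Ω, primitiveF f z (u.fn z)

/-- The Nehari manifold `{u ∈ W^{1,p}_0(Ω) : ⟨φ'(u), u⟩ = 0, u ≠ 0}`, with `φ'` the Fréchet
derivative of the energy. -/
def nehari {N : ℕ} (Ω : Set (Eucl N)) (p q : ℝ) [Fact (1 ≤ ENNReal.ofReal p)]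
    (a : Eucl N → ℝ) (f : Eucl N → ℝ → ℝ) : Set (W0 Ω p) :=
  {u | fderiv ℝ (energy Ω p q a f) u u = 0 ∧ u ≠ 0}

end

open Filter Topology

/-! The energy φ has mountain-pass geometry along rays. Condition (iv) makes `f(z,tx)x / t^(p-1)`
nondecreasing in `t > 0`; integrating in `t` gives `F(z,x) - F(z,tx) ≤ (1-t^p)/p · f(z,x)x`
(`IsPowerMonotone.primitive_sub_le`). With `(t^q-1)/q ≤ (t^p-1)/p` this yields `φ(tu) ≤ φ(u)` for
all `t ≥ 0` when `u` is on the Nehari manifold (`energy_smul_le`). So `u` can be compared with its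
multiple on a small sphere `‖Du‖_p = ρ`, where `φ ≥ η > 0` (`exists_energy_ge_on_sphere`).
Conversely, the ray through any nonzero function starts at energy 0, reaches height η on the sphere
and returns to energy `≤ 0` by superlinearity (`exists_energy_smul_nonpos`); its interior maximum
lies on the manifold.

The sphere estimate is the delicate point: `F ≤ C(|x|^p + |x|^σ)` holds with a `C` that need not be
small, and `a` may come arbitrarily close to 0. The remedy is the Ehrling-type inequality
`W0.exists_integral_rpow_le`. For `u = ρw` with `‖Dw‖_p = 1`, its ε-part is absorbed by `ρ^p/p`, and
its weighted part, of order `ρ^p ∫a|Dw|^q`, by `(ρ^q/q) ∫a|Dw|^q`, since `q < p` and ρ is small.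

As `fderiv` is 0 wherever differentiability fails, φ must be shown differentiable:
`IsIntegrand.exists_hasFDerivAt` differentiates integral functionals on `L^σ`, and
`W0.exists_embedding` transports the result to `W0`. -/

/-! ### Sobolev inequalities and embeddings -/

theorem enorm_gradient {N : ℕ} (φ : Eucl N → ℝ) (z : Eucl N) :
    ‖gradient φ z‖ₑ = ‖fderiv ℝ φ z‖ₑ := by
  rw [gradient, LinearIsometryEquiv.enorm_map]

theorem eLpNorm_gradient {N : ℕ} (φ : Eucl N → ℝ) (p : ℝ≥0∞) (μ : Measure (Eucl N)) :
    eLpNorm (gradient φ) p μ = eLpNorm (fderiv ℝ φ) p μ :=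
  eLpNorm_congr_enorm_ae (Filter.Eventually.of_forall fun z => enorm_gradient φ z)

theorem IsTestFunction.contDiff_one {N : ℕ} {Ω : Set (Eucl N)} {φ : Eucl N → ℝ}
    (h : IsTestFunction Ω φ) : ContDiff ℝ 1 φ := h.smooth.of_le (by exact_mod_cast le_top)

theorem IsTestFunction.continuous_gradient {N : ℕ} {Ω : Set (Eucl N)} {φ : Eucl N → ℝ}
    (h : IsTestFunction Ω φ) : Continuous (gradient φ) :=
  (InnerProductSpace.toDual ℝ (Eucl N)).symm.continuous.comp
    (h.contDiff_one.continuous_fderiv one_ne_zero)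

theorem IsTestFunction.support_fderiv_subset {N : ℕ} {Ω : Set (Eucl N)} {φ : Eucl N → ℝ}
    (h : IsTestFunction Ω φ) : Function.support (fderiv ℝ φ) ⊆ Ω :=
  (_root_.support_fderiv_subset ℝ).trans h.support_subset

theorem IsTestFunction.eLpNorm_fderiv {N : ℕ} {Ω : Set (Eucl N)} {φ : Eucl N → ℝ}
    (h : IsTestFunction Ω φ) (p : ℝ≥0∞) :
    eLpNorm (fderiv ℝ φ) p volume = eLpNorm (gradient φ) p (volume.restrict Ω) := by
  rw [eLpNorm_gradient]
  refine (eLpNorm_restrict_eq_of_support_subset (f := fderiv ℝ φ) (s := Ω) ?_).symm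
  exact h.support_fderiv_subset

/-- In dimension one, a test function is bounded by the `L¹` norm of its derivative. -/
theorem enorm_le_lintegral_fderiv_of_dim_one {φ : Eucl 1 → ℝ} (h : ContDiff ℝ 1 φ)
    (hc : HasCompactSupport φ) (x : Eucl 1) : ‖φ x‖ₑ ≤ ∫⁻ z, ‖fderiv ℝ φ z‖ₑ := by
  -- A measure-preserving isometry with the line reduces the claim to the bound of a compactly
  -- supported function by the integral of its derivative.
  let ι : ℝ ≃ₗᵢ[ℝ] Eucl 1 :=
    { LinearEquiv.ofBijective (LinearMap.toSpanSingleton ℝ (Eucl 1) (EuclideanSpace.single 0 1))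
        ⟨fun s t hst => by
            have := congrArg (fun v : Eucl 1 => v 0) hst
            simpa [LinearMap.toSpanSingleton] using this,
          fun v => ⟨v 0, by
            ext i
            fin_cases i
            simp [LinearMap.toSpanSingleton]⟩⟩ with
      norm_map' := fun t => by simp [LinearMap.toSpanSingleton, norm_smul] }
  have hmp : MeasurePreserving ι := ι.measurePreserving
  have hd : ContDiff ℝ 1 (φ ∘ ι) := h.comp ι.contDiff
  have hcs : HasCompactSupport (φ ∘ ι) := hc.comp_homeomorph ι.toHomeomorph
  have h1 := hcs.enorm_le_lintegral_Ici_deriv hd (ι.symm x)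
  have h2 : ∀ t, ‖deriv (φ ∘ ι) t‖ₑ ≤ ‖fderiv ℝ φ (ι t)‖ₑ := by
    intro t
    have e : HasDerivAt (φ ∘ ι) (fderiv ℝ φ (ι t) (ι 1)) t := by
      have a := (h.differentiable one_ne_zero (ι t)).hasFDerivAt
      have b : HasDerivAt ι (ι 1) t := by
        simpa using (ι.toContinuousLinearEquiv.hasFDerivAt (x := t)).hasDerivAt
      exact a.comp_hasDerivAt t b
    rw [e.deriv]
    have := (fderiv ℝ φ (ι t)).le_opNorm (ι 1)
    rw [ι.norm_map, norm_one, mul_one] at this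
    rw [enorm_le_iff_norm_le]
    exact this
  calc ‖φ x‖ₑ = ‖(φ ∘ ι) (ι.symm x)‖ₑ := by simp
    _ ≤ _ := h1
    _ ≤ ∫⁻ t, ‖deriv (φ ∘ ι) t‖ₑ := setLIntegral_le_lintegral _ _
    _ ≤ ∫⁻ t, ‖fderiv ℝ φ (ι t)‖ₑ := lintegral_mono h2
    _ = ∫⁻ z, ‖fderiv ℝ φ z‖ₑ :=
      hmp.lintegral_comp (h.continuous_fderiv one_ne_zero).enorm.measurable

/-- Sobolev inequality for test functions on a bounded set, in all dimensions and for all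
non-supercritical exponents. -/
theorem exists_sobolev_testFunction {N : ℕ} (hN : 1 ≤ N) {Ω : Set (Eucl N)}
    (hb : Bornology.IsBounded Ω) {p σ : ℝ} (hp : 1 ≤ p) (hσ : 1 ≤ σ)
    (h : 1 / p - 1 / N ≤ 1 / σ) :
    ∃ C : ℝ≥0, ∀ φ, IsTestFunction Ω φ → eLpNorm φ (ENNReal.ofReal σ) (volume.restrict Ω) ≤
      C * eLpNorm (gradient φ) (ENNReal.ofReal p) (volume.restrict Ω) := by
  have hfin : volume Ω < ⊤ := hb.measure_lt_top
  have hfin' : (volume.restrict Ω) univ ≠ ⊤ := by simpa using hfin.ne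
  have hN0 : (0 : ℝ) < N := by exact_mod_cast hN
  have hσ0 : 0 < σ := by linarith
  have hp0 : 0 < p := by linarith
  rcases hN.eq_or_lt with h1 | h2
  · subst h1
    set V := (volume.restrict Ω) univ with hV
    set e1 : ℝ := 1 / σ
    set e2 : ℝ := 1 - 1 / p
    have he1 : 0 ≤ e1 := by positivity
    have he2 : 0 ≤ e2 := by simp only [e2, sub_nonneg]; exact (div_le_one hp0).2 hp
    refine ⟨(V ^ e1 * V ^ e2).toNNReal, fun φ hφ => ?_⟩
    rw [ENNReal.coe_toNNReal (ENNReal.mul_ne_top (ENNReal.rpow_ne_top_of_nonneg he1 hfin')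
      (ENNReal.rpow_ne_top_of_nonneg he2 hfin'))]
    have hmeas : AEStronglyMeasurable (gradient φ) (volume.restrict Ω) :=
      hφ.continuous_gradient.aestronglyMeasurable
    have hA : eLpNorm φ (ENNReal.ofReal σ) (volume.restrict Ω) ≤
        eLpNorm (gradient φ) 1 (volume.restrict Ω) * V ^ e1 := by
      have hb : ∀ x, ‖φ x‖ₑ ≤ ‖eLpNorm (gradient φ) 1 (volume.restrict Ω)‖ₑ := by
        intro x
        rw [enorm_eq_self, ← hφ.eLpNorm_fderiv, eLpNorm_one_eq_lintegral_enorm]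
        exact enorm_le_lintegral_fderiv_of_dim_one hφ.contDiff_one hφ.compactSupport x
      refine (eLpNorm_mono_enorm (g := fun _ => eLpNorm (gradient φ) 1 (volume.restrict Ω)) hb).trans
        ?_
      rw [eLpNorm_const' _ (by simpa using hσ0) ENNReal.ofReal_ne_top]
      simp [ENNReal.toReal_ofReal hσ0.le, e1, V]
    have hB := eLpNorm_le_eLpNorm_mul_rpow_measure_univ (p := 1) (q := ENNReal.ofReal p)
      (by simpa using hp) hmeas
    rw [ENNReal.toReal_ofReal hp0.le, ENNReal.toReal_one, div_one] at hB
    calc _ ≤ _ := hA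
      _ ≤ eLpNorm (gradient φ) (ENNReal.ofReal p) (volume.restrict Ω) * V ^ e2 * V ^ e1 := by
        gcongr
      _ = _ := by ring
  · have h2' : (1 : ℝ) < N := by exact_mod_cast h2
    -- The exponent `p' = 1/t` is the one whose Sobolev conjugate is σ, raised to 1 if it would be
    -- smaller. It satisfies `p' ≤ p` and `p' < N`, so the case `p ≥ N` is covered too; Hölder on
    -- the finite measure then passes from `p'` to `p`.
    set t : ℝ := min 1 (1 / N + 1 / σ) with ht
    have ht0 : 0 < t := lt_min one_pos (by positivity)
    have htp : 1 / p ≤ t := le_min ((div_le_one hp0).2 hp) (by linarith)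
    have htN : 1 / N < t := lt_min ((div_lt_one hN0).2 h2') (by linarith [one_div_pos.2 hσ0])
    set p' : ℝ≥0 := ⟨1 / t, by positivity⟩ with hp'
    have hp'1 : (1 : ℝ) ≤ p' := by
      change 1 ≤ 1 / t
      exact (one_le_div ht0).2 (min_le_left _ _)
    have hp'p : (p' : ℝ) ≤ p := by
      change 1 / t ≤ p
      rw [div_le_iff₀ ht0]
      rw [div_le_iff₀ hp0] at htp
      linarith
    have hdim : Module.finrank ℝ (Eucl N) = N := by simp
    set V := (volume.restrict Ω) univ with hV
    set e : ℝ := 1 / p' - 1 / p with he_def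
    have he : 0 ≤ e := sub_nonneg.2 (one_div_le_one_div_of_le (by linarith) hp'p)
    set C := eLpNormLESNormFDerivOfLeConst ℝ (volume : Measure (Eucl N)) Ω p' σ.toNNReal
    refine ⟨C * (V ^ e).toNNReal, fun φ hφ => ?_⟩
    rw [ENNReal.coe_mul, ENNReal.coe_toNNReal (ENNReal.rpow_ne_top_of_nonneg he hfin')]
    have hmeas : AEStronglyMeasurable (gradient φ) (volume.restrict Ω) :=
      hφ.continuous_gradient.aestronglyMeasurable
    have hA := eLpNorm_le_eLpNorm_fderiv_of_le (volume : Measure (Eucl N)) hφ.contDiff_one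
      ((subset_tsupport φ).trans hφ.support_subset) (p := p') (q := σ.toNNReal)
      (by exact_mod_cast hp'1)
      (by
        rw [hdim]
        have : (p' : ℝ) < N := by
          change 1 / t < N
          rw [div_lt_iff₀ ht0]
          rwa [div_lt_iff₀ hN0, mul_comm] at htN
        exact_mod_cast this)
      (by
        rw [hdim, Real.coe_toNNReal _ hσ0.le]
        have : ((p' : ℝ)⁻¹) = t := by
          change (1 / t)⁻¹ = t
          simp
        rw [NNReal.coe_inv, this, inv_eq_one_div, inv_eq_one_div]
        linarith [min_le_right (1 : ℝ) (1 / N + 1 / σ)]) hb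
    rw [hφ.eLpNorm_fderiv,
      ← eLpNorm_restrict_eq_of_support_subset ((subset_tsupport φ).trans hφ.support_subset)] at hA
    have hB := eLpNorm_le_eLpNorm_mul_rpow_measure_univ (p := (p' : ℝ≥0∞)) (q := ENNReal.ofReal p)
      (by
        rw [← ENNReal.ofReal_coe_nnreal]
        exact ENNReal.ofReal_le_ofReal hp'p) hmeas
    rw [ENNReal.toReal_ofReal hp0.le, ENNReal.coe_toReal] at hB
    calc eLpNorm φ (ENNReal.ofReal σ) (volume.restrict Ω)
        ≤ C * eLpNorm (gradient φ) p' (volume.restrict Ω) := hA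
      _ ≤ C * (eLpNorm (gradient φ) (ENNReal.ofReal p) (volume.restrict Ω) * V ^ e) := by
        gcongr
      _ = _ := by ring

/-- Sobolev inequality on `W^{1,p}_0(Ω)`, with a gradient norm of any order `s ≤ p`. -/
theorem W0.exists_sobolev {N : ℕ} (hN : 1 ≤ N) {Ω : Set (Eucl N)}
    (hb : Bornology.IsBounded Ω) {p : ℝ} [Fact (1 ≤ ENNReal.ofReal p)] {s σ : ℝ} (hs : 1 ≤ s)
    (hsp : s ≤ p) (hσ : 1 ≤ σ) (h : 1 / s - 1 / N ≤ 1 / σ) :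
    ∃ C : ℝ≥0, ∀ u : W0 Ω p, eLpNorm u.fn (ENNReal.ofReal σ) (volume.restrict Ω) ≤
      C * eLpNorm u.grad (ENNReal.ofReal s) (volume.restrict Ω) := by
  obtain ⟨C, hC⟩ := exists_sobolev_testFunction hN hb hs hσ h
  refine ⟨C, fun u => ?_⟩
  have hp0 : 0 < p := by linarith
  have hfin : (volume.restrict Ω) univ ≠ ⊤ := by simpa using hb.measure_lt_top.ne
  obtain ⟨w, hw, hlim⟩ := mem_closure_iff_seq_limit.1 u.2
  have hlim1 : Tendsto (fun n => (w n).1) atTop (𝓝 u.fn) := (continuous_fst.tendsto _).comp hlim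
  have hlim2 : Tendsto (fun n => (w n).2) atTop (𝓝 u.grad) := (continuous_snd.tendsto _).comp hlim
  obtain ⟨ns, hns, hae⟩ := (tendstoInMeasure_of_tendsto_Lp hlim1).exists_seq_tendsto_ae
  set V : ℝ≥0∞ := (volume.restrict Ω) univ ^ (1 / s - 1 / p)
  have hV : V ≠ ⊤ := ENNReal.rpow_ne_top_of_nonneg
    (sub_nonneg.2 (one_div_le_one_div_of_le (by linarith) hsp)) hfin
  have hbound : ∀ n, eLpNorm (w n).1 (ENNReal.ofReal σ) (volume.restrict Ω) ≤
      C * (eLpNorm u.grad (ENNReal.ofReal s) (volume.restrict Ω) +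
        ‖(w n).2 - u.grad‖ₑ * V) := by
    intro n
    obtain ⟨φ, hφ, h1, h2⟩ := hw n
    rw [eLpNorm_congr_ae h1]
    refine (hC φ hφ).trans ?_
    rw [← eLpNorm_congr_ae h2]
    gcongr
    have e : ((w n).2 : Eucl N → Eucl N) =ᵐ[volume.restrict Ω]
        (u.grad : Eucl N → Eucl N) + (((w n).2 - u.grad : Lp _ _ _) : Eucl N → Eucl N) := by
      filter_upwards [Lp.coeFn_sub (w n).2 u.grad] with z hz
      rw [Pi.add_apply, hz, Pi.sub_apply, add_sub_cancel]
    rw [eLpNorm_congr_ae e]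
    refine (eLpNorm_add_le (Lp.aestronglyMeasurable _) (Lp.aestronglyMeasurable _)
      (by simpa using hs)).trans ?_
    gcongr
    rw [Lp.enorm_def]
    have := eLpNorm_le_eLpNorm_mul_rpow_measure_univ (p := ENNReal.ofReal s)
      (q := ENNReal.ofReal p) (ENNReal.ofReal_le_ofReal hsp)
      (Lp.aestronglyMeasurable ((w n).2 - u.grad))
    rwa [ENNReal.toReal_ofReal hp0.le, ENNReal.toReal_ofReal (by linarith)] at this
  have hz : Tendsto (fun n => ‖(w n).2 - u.grad‖ₑ) atTop (𝓝 0) := by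
    have := (tendsto_iff_norm_sub_tendsto_zero.1 hlim2)
    rw [tendsto_zero_iff_enorm_tendsto_zero] at this
    simpa using this
  have hb2 : Tendsto (fun n => C * (eLpNorm u.grad (ENNReal.ofReal s) (volume.restrict Ω) +
      ‖(w n).2 - u.grad‖ₑ * V)) atTop
      (𝓝 (C * (eLpNorm u.grad (ENNReal.ofReal s) (volume.restrict Ω) + 0 * V))) :=
    ENNReal.Tendsto.const_mul (tendsto_const_nhds.add
      (ENNReal.Tendsto.mul_const hz (Or.inr hV))) (Or.inr ENNReal.coe_ne_top)
  rw [zero_mul, add_zero] at hb2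
  -- Fatou suffices for the left side: the `L^σ` norm is lower semicontinuous under a.e.
  -- convergence, so no convergence in `L^σ` is needed.
  refine (Lp.eLpNorm_lim_le_liminf_eLpNorm (fun n => Lp.aestronglyMeasurable _) _ hae).trans ?_
  refine (liminf_le_liminf (Eventually.of_forall fun n => hbound (ns n))).trans ?_
  exact (hb2.comp hns.tendsto_atTop).liminf_eq.le

/-- The gradient, as a continuous linear map. -/
noncomputable def W0.gradL {N : ℕ} (Ω : Set (Eucl N)) (p : ℝ) [Fact (1 ≤ ENNReal.ofReal p)] :
    W0 Ω p →L[ℝ] Lp (Eucl N) (ENNReal.ofReal p) (volume.restrict Ω) :=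
  (ContinuousLinearMap.snd ℝ _ _).comp (testPairs Ω p).topologicalClosure.subtypeL

theorem W0.gradL_apply {N : ℕ} {Ω : Set (Eucl N)} {p : ℝ} [Fact (1 ≤ ENNReal.ofReal p)]
    (u : W0 Ω p) : W0.gradL Ω p u = u.grad := rfl

/-- A Sobolev inequality gives a continuous embedding into `L^σ(Ω)`. -/
theorem W0.exists_embedding {N : ℕ} {Ω : Set (Eucl N)} {p σ : ℝ} [Fact (1 ≤ ENNReal.ofReal p)]
    [Fact (1 ≤ ENNReal.ofReal σ)] {C : ℝ≥0}
    (h : ∀ u : W0 Ω p, eLpNorm u.fn (ENNReal.ofReal σ) (volume.restrict Ω) ≤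
      C * eLpNorm u.grad (ENNReal.ofReal p) (volume.restrict Ω)) :
    ∃ T : W0 Ω p →L[ℝ] Lp ℝ (ENNReal.ofReal σ) (volume.restrict Ω),
      (∀ u, T u =ᵐ[volume.restrict Ω] u.fn) ∧ ∀ u, ‖T u‖ ≤ C * ‖u.grad‖ := by
  have hm : ∀ u : W0 Ω p, MemLp u.fn (ENNReal.ofReal σ) (volume.restrict Ω) := fun u =>
    ⟨Lp.aestronglyMeasurable _, (h u).trans_lt
      (ENNReal.mul_lt_top ENNReal.coe_lt_top (Lp.eLpNorm_lt_top _))⟩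
  let L : W0 Ω p →ₗ[ℝ] Lp ℝ (ENNReal.ofReal σ) (volume.restrict Ω) :=
    { toFun := fun u => (hm u).toLp
      map_add' := fun u v => by
        rw [← MemLp.toLp_add (hm u) (hm v)]
        exact (MemLp.toLp_eq_toLp_iff _ _).2 (Lp.coeFn_add u.fn v.fn)
      map_smul' := fun c u => by
        rw [RingHom.id_apply, ← MemLp.toLp_const_smul c (hm u)]
        exact (MemLp.toLp_eq_toLp_iff _ _).2 (Lp.coeFn_smul c u.fn) }
  have hL : ∀ u, ‖L u‖ ≤ C * ‖u.grad‖ := by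
    intro u
    change ‖(hm u).toLp‖ ≤ _
    rw [Lp.norm_toLp, Lp.norm_def, ← ENNReal.coe_toReal C, ← ENNReal.toReal_mul]
    exact ENNReal.toReal_mono
      (ENNReal.mul_ne_top ENNReal.coe_ne_top (Lp.eLpNorm_lt_top _).ne) (h u)
  refine ⟨L.mkContinuous C fun u => (hL u).trans ?_, fun u => (hm u).coeFn_toLp, hL⟩
  gcongr
  exact le_max_right _ _

/-! ### Differentiability of integral functionals on `L^σ` -/

theorem Lp.norm_rpow_eq_integral {α E : Type*} [MeasurableSpace α] {μ : Measure α}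
    [NormedAddCommGroup E] {σ : ℝ} (hσ : 0 < σ) (v : Lp E (ENNReal.ofReal σ) μ) :
    ‖v‖ ^ σ = ∫ z, ‖v z‖ ^ σ ∂μ := by
  have h0 : 0 ≤ ∫ z, ‖v z‖ ^ σ ∂μ := integral_nonneg fun z => by positivity
  rw [Lp.norm_def, (Lp.memLp v).eLpNorm_eq_integral_rpow_norm (by simpa using hσ)
    ENNReal.ofReal_ne_top, ENNReal.toReal_ofReal hσ.le,
    ENNReal.toReal_ofReal (by positivity), ← Real.rpow_mul h0, inv_mul_cancel₀ hσ.ne',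
    Real.rpow_one]

/-- `g(z, ·)` is the derivative of the integrand `G(z, ·)`, it grows at most like `|x|^(σ-1)`, and
superposition with `G` and `g` preserves measurability. -/
structure IsIntegrand {α E : Type*} [MeasurableSpace α] (μ : Measure α)
    [NormedAddCommGroup E] [NormedSpace ℝ E] (σ : ℝ) (G : α → E → ℝ) (g : α → E → E →L[ℝ] ℝ) :
    Prop where
  meas : ∀ v : α → E, AEStronglyMeasurable v μ → AEStronglyMeasurable (fun z => G z (v z)) μ
  meas_deriv : ∀ v : α → E, AEStronglyMeasurable v μ →
    AEStronglyMeasurable (fun z => g z (v z)) μ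
  zero : ∀ᵐ z ∂μ, G z 0 = 0
  deriv : ∀ᵐ z ∂μ, ∀ x, HasFDerivAt (G z) (g z x) x
  bound : ∃ C, 0 ≤ C ∧ ∀ᵐ z ∂μ, ∀ x, ‖g z x‖ ≤ C * (1 + ‖x‖) ^ (σ - 1)

namespace IsIntegrand

variable {α E : Type*} [MeasurableSpace α] {μ : Measure α} [IsFiniteMeasure μ]
    [NormedAddCommGroup E] [NormedSpace ℝ E] {σ : ℝ} {G : α → E → ℝ} {g : α → E → E →L[ℝ] ℝ}

-- Mean value inequality on the closed ball of radius `‖y‖` about `x`, where all points have norm at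
-- most `‖x‖ + ‖y‖`. One constant serves both bounds.
omit [IsFiniteMeasure μ] in
theorem exists_lipschitz_bound (h : IsIntegrand μ σ G g) (hσ : 1 < σ) : ∃ C, 0 ≤ C ∧
    ∀ᵐ z ∂μ, ∀ x y, ‖g z x‖ ≤ C * (1 + ‖x‖) ^ (σ - 1) ∧
      |G z (x + y) - G z x| ≤ C * (1 + ‖x‖ + ‖y‖) ^ (σ - 1) * ‖y‖ := by
  obtain ⟨C, hC, hb⟩ := h.bound
  refine ⟨C, hC, ?_⟩
  filter_upwards [hb, h.deriv] with z hz hd x y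
  refine ⟨hz x, ?_⟩
  have := Convex.norm_image_sub_le_of_norm_hasFDerivWithin_le (f := G z) (f' := g z)
    (s := Metric.closedBall x ‖y‖) (C := C * (1 + ‖x‖ + ‖y‖) ^ (σ - 1)) (x := x) (y := x + y)
    (fun w _ => (hd w).hasFDerivWithinAt)
    (fun w hw => (hz w).trans (by
      have : ‖w‖ ≤ ‖x‖ + ‖y‖ := by
        have h1 : ‖w - x‖ ≤ ‖y‖ := by simpa [dist_eq_norm] using hw
        have := norm_add_le x (w - x)
        rw [add_sub_cancel] at this
        linarith
      exact mul_le_mul_of_nonneg_left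
        (Real.rpow_le_rpow (by positivity) (by linarith) (by linarith)) hC)) (convex_closedBall _ _) (by simp) (by simp)
  simpa using this

omit [NormedSpace ℝ E] in
theorem memLp_one_add_norm {u : α → E} (hu : MemLp u (ENNReal.ofReal σ) μ) :
    MemLp (fun z => 1 + ‖u z‖) (ENNReal.ofReal σ) μ :=
  MemLp.add (f := fun _ => (1 : ℝ)) (memLp_const 1) hu.norm

omit [NormedSpace ℝ E] in
theorem norm_one_add_norm (x : E) : ‖1 + ‖x‖‖ = 1 + ‖x‖ :=
  Real.norm_of_nonneg (add_nonneg zero_le_one (norm_nonneg x))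

omit [NormedSpace ℝ E] in
theorem integrable_one_add_norm_rpow (hσ : 0 < σ) {u : α → E}
    (hu : MemLp u (ENNReal.ofReal σ) μ) : Integrable (fun z => (1 + ‖u z‖) ^ σ) μ := by
  have h1 := (memLp_one_add_norm hu).integrable_norm_rpow (by simpa using hσ) ENNReal.ofReal_ne_top
  simpa only [ENNReal.toReal_ofReal hσ.le, norm_one_add_norm] using h1

/-- Growth of order `σ - 1` is exactly what puts the derivative in the dual exponent `σ/(σ-1)`. -/
theorem memLp_deriv (h : IsIntegrand μ σ G g) (hσ : 1 < σ) {u : α → E}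
    (hu : MemLp u (ENNReal.ofReal σ) μ) :
    MemLp (fun z => g z (u z)) (ENNReal.ofReal (σ / (σ - 1))) μ := by
  obtain ⟨C, hC, hb⟩ := h.bound
  have h2 := ((memLp_one_add_norm hu).norm_rpow_div (ENNReal.ofReal (σ - 1))).const_mul C
  rw [← ENNReal.ofReal_div_of_pos (by linarith), ENNReal.toReal_ofReal (by linarith)] at h2
  simp only [norm_one_add_norm] at h2
  refine h2.mono (h.meas_deriv u hu.1) ?_
  filter_upwards [hb] with z hz
  exact (hz (u z)).trans (le_abs_self _)

theorem holderConjugate (hσ : 1 < σ) : (σ / (σ - 1)).HolderConjugate σ :=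
  (Real.HolderConjugate.conjExponent hσ).symm

theorem integrable_deriv (h : IsIntegrand μ σ G g) (hσ : 1 < σ) {u v : α → E}
    (hu : MemLp u (ENNReal.ofReal σ) μ) (hv : MemLp v (ENNReal.ofReal σ) μ) :
    Integrable (fun z => g z (u z) (v z)) μ := by
  have : ENNReal.HolderTriple (ENNReal.ofReal (σ / (σ - 1))) (ENNReal.ofReal σ) 1 :=
    (holderConjugate hσ).ennrealOfReal
  exact memLp_one_iff_integrable.1 (ContinuousLinearMap.memLp_of_bilin 1
    (ContinuousLinearMap.id ℝ (E →L[ℝ] ℝ)) (h.memLp_deriv hσ hu) hv)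

theorem integrable (h : IsIntegrand μ σ G g) (hσ : 1 < σ) {u : α → E}
    (hu : MemLp u (ENNReal.ofReal σ) μ) : Integrable (fun z => G z (u z)) μ := by
  obtain ⟨C, hC, hb⟩ := h.exists_lipschitz_bound hσ
  have h2 := (integrable_one_add_norm_rpow (by linarith) hu).const_mul C
  refine h2.mono (h.meas u hu.1) ?_
  filter_upwards [hb, h.zero] with z hz h0
  have h3 := (hz 0 (u z)).2
  rw [zero_add, h0, sub_zero, norm_zero, add_zero] at h3
  rw [Real.norm_eq_abs]
  refine le_trans ?_ (le_abs_self _)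
  refine h3.trans ?_
  rw [mul_assoc]
  gcongr
  calc (1 + ‖u z‖) ^ (σ - 1) * ‖u z‖ ≤ (1 + ‖u z‖) ^ (σ - 1) * (1 + ‖u z‖) := by
        gcongr; linarith
    _ = (1 + ‖u z‖) ^ σ := by
        rw [← Real.rpow_add_one (by positivity)]
        ring_nf

omit [IsFiniteMeasure μ] [NormedSpace ℝ E] in
/-- The integral of a nonnegative superposition, which vanishes in the limit pointwise and is
dominated by `K (b + ‖·‖^σ)`, is small near the origin of `L^σ`. -/
theorem tendsto_integral_of_dominated [Fact (1 ≤ ENNReal.ofReal σ)] (hσ : 1 < σ)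
    {Q : α → E → ℝ} {b : α → ℝ} {K : ℝ} (hb : Integrable b μ)
    (hQm : ∀ v : Lp E (ENNReal.ofReal σ) μ, AEStronglyMeasurable (fun z => Q z (v z)) μ)
    (hQ0 : ∀ z y, 0 ≤ Q z y) (hQ : ∀ᵐ z ∂μ, Tendsto (Q z) (𝓝 0) (𝓝 0))
    (hQb : ∀ᵐ z ∂μ, ∀ y, Q z y ≤ b z + K * ‖y‖ ^ σ) :
    Tendsto (fun v : Lp E (ENNReal.ofReal σ) μ => ∫ z, Q z (v z) ∂μ) (𝓝 0) (𝓝 0) := by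
  have hσ0 : 0 < σ := by linarith
  have hint : ∀ v : Lp E (ENNReal.ofReal σ) μ, Integrable (fun z => ‖v z‖ ^ σ) μ := fun v => by
    have := (Lp.memLp v).integrable_norm_rpow (by simpa using hσ0) ENNReal.ofReal_ne_top
    rwa [ENNReal.toReal_ofReal hσ0.le] at this
  have hQi : ∀ v : Lp E (ENNReal.ofReal σ) μ, Integrable (fun z => Q z (v z)) μ := fun v => by
    refine (hb.add ((hint v).const_mul K)).mono (hQm v) ?_
    filter_upwards [hQb] with z hz
    rw [Real.norm_of_nonneg (hQ0 _ _)]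
    exact (hz _).trans (le_abs_self _)
  -- The majorant of `Q` depends on `v`. Subtracting its variable part and keeping the positive part
  -- leaves the fixed majorant `|b|`, so dominated convergence applies along a.e. convergent
  -- subsequences; the subtracted part integrates to `K‖v‖^σ`, which tends to 0.
  let P : Lp E (ENNReal.ofReal σ) μ → α → ℝ := fun v z => max (Q z (v z) - K * ‖v z‖ ^ σ) 0
  have hPm : ∀ v, AEStronglyMeasurable (P v) μ := fun v =>
    ((hQm v).sub ((hint v).const_mul K).1).sup aestronglyMeasurable_const
  have hPi : ∀ v, Integrable (P v) μ := fun v => ((hQi v).sub ((hint v).const_mul K)).pos_part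
  have hP : Tendsto (fun v => ∫ z, P v z ∂μ) (𝓝 0) (𝓝 0) := by
    refine tendsto_of_subseq_tendsto fun vs hvs => ?_
    obtain ⟨ms, -, hms⟩ := (tendstoInMeasure_of_tendsto_Lp hvs).exists_seq_tendsto_ae
    refine ⟨ms, ?_⟩
    have : Tendsto (fun n => ∫ z, P (vs (ms n)) z ∂μ) atTop (𝓝 (∫ _, (0 : ℝ) ∂μ)) := by
      refine tendsto_integral_of_dominated_convergence (fun z => |b z|)
        (fun n => hPm _) hb.abs (fun n => ?_) ?_
      · filter_upwards [hQb] with z hz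
        rw [Real.norm_of_nonneg (le_max_right _ _)]
        exact max_le ((by linarith [hz (vs (ms n) z)] : _ ≤ b z).trans (le_abs_self _))
          (abs_nonneg _)
      · filter_upwards [hms, hQ, Lp.coeFn_zero E (ENNReal.ofReal σ) μ] with z hz hq h0
        rw [h0] at hz
        have h1 : Tendsto (fun n => Q z (vs (ms n) z)) atTop (𝓝 0) := hq.comp hz
        have h2 : Tendsto (fun n => K * ‖vs (ms n) z‖ ^ σ) atTop (𝓝 0) := by
          have := (hz.norm.rpow_const (p := σ) (Or.inr hσ0.le)).const_mul K
          simpa [Real.zero_rpow hσ0.ne'] using this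
        have := (h1.sub h2).max (tendsto_const_nhds (x := (0 : ℝ)))
        simpa [P] using this
    simpa using this
  have hN : Tendsto (fun v : Lp E (ENNReal.ofReal σ) μ => K * ‖v‖ ^ σ) (𝓝 0) (𝓝 0) := by
    have := ((continuous_norm.tendsto (0 : Lp E (ENNReal.ofReal σ) μ)).rpow_const (p := σ)
      (Or.inr hσ0.le)).const_mul K
    simpa [Real.zero_rpow hσ0.ne'] using this
  have hsum := hP.add hN
  rw [add_zero] at hsum
  refine squeeze_zero (fun v => integral_nonneg fun z => hQ0 _ _) (fun v => ?_) hsum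
  rw [Lp.norm_rpow_eq_integral hσ0, ← integral_const_mul,
    ← integral_add (hPi v) ((hint v).const_mul K)]
  refine integral_mono (hQi v) ((hPi v).add ((hint v).const_mul K)) fun z => ?_
  have := le_max_left (Q z (v z) - K * ‖v z‖ ^ σ) 0
  simp only [P]
  linarith

/-- Hölder bounds the integrated remainder by `‖S‖_τ ‖v‖_σ`, where `S` is the pointwise remainder
divided by `‖v‖` and τ is conjugate to σ. Pointwise differentiability makes `S` vanish in the limit,
and the growth bound dominates `S^τ`. -/
theorem exists_hasFDerivAt [Fact (1 ≤ ENNReal.ofReal σ)] (h : IsIntegrand μ σ G g) (hσ : 1 < σ)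
    (u : Lp E (ENNReal.ofReal σ) μ) :
    ∃ L : Lp E (ENNReal.ofReal σ) μ →L[ℝ] ℝ,
      HasFDerivAt (fun v : Lp E (ENNReal.ofReal σ) μ => ∫ z, G z (v z) ∂μ) L u ∧
      ∀ v, L v = ∫ z, g z (u z) (v z) ∂μ := by
  have hσ0 : 0 < σ := by linarith
  have hσ1 : 0 < σ - 1 := by linarith
  set τ : ℝ := σ / (σ - 1) with hτ
  have hτ0 : 0 < τ := by positivity
  have hconj : τ.HolderConjugate σ := holderConjugate hσ
  have : ENNReal.HolderConjugate (ENNReal.ofReal τ) (ENNReal.ofReal σ) := hconj.ennrealOfReal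
  have hτ1 : Fact (1 ≤ ENNReal.ofReal τ) := ⟨by simpa using hconj.lt.le⟩
  have hk := h.memLp_deriv hσ (Lp.memLp u)
  set L : Lp E (ENNReal.ofReal σ) μ →L[ℝ] ℝ :=
    (ContinuousLinearMap.id ℝ (E →L[ℝ] ℝ)).lpPairing μ (ENNReal.ofReal τ) (ENNReal.ofReal σ)
      hk.toLp with hL
  have hLv : ∀ v, L v = ∫ z, g z (u z) (v z) ∂μ := by
    intro v
    rw [hL, ContinuousLinearMap.lpPairing_eq_integral]
    refine integral_congr_ae ?_
    filter_upwards [hk.coeFn_toLp] with z hz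
    simp [hz]
  refine ⟨L, ?_, hLv⟩
  obtain ⟨C, hC, hb⟩ := h.exists_lipschitz_bound hσ
  set R : α → E → ℝ := fun z y => G z (u z + y) - G z (u z) - g z (u z) y with hR
  set S : α → E → ℝ := fun z y => |R z y| / ‖y‖ with hS
  have hS0 : ∀ z y, 0 ≤ S z y := fun z y => by positivity
  have hSR : ∀ z y, |R z y| = S z y * ‖y‖ := by
    intro z y
    rcases eq_or_ne y 0 with rfl | hy
    · simp [hR]
    · simp only [hS]
      field_simp [norm_ne_zero_iff.2 hy]
  have hRm : ∀ v : Lp E (ENNReal.ofReal σ) μ, AEStronglyMeasurable (fun z => R z (v z)) μ := by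
    intro v
    refine ((h.meas _ ((Lp.aestronglyMeasurable u).add (Lp.aestronglyMeasurable v))).sub
      (h.meas _ (Lp.aestronglyMeasurable u))).sub ?_
    exact (h.integrable_deriv hσ (Lp.memLp u) (Lp.memLp v)).1
  have hSm : ∀ v : Lp E (ENNReal.ofReal σ) μ, AEStronglyMeasurable (fun z => S z (v z)) μ :=
    fun v => ((hRm v).norm.aemeasurable.div
      (Lp.aestronglyMeasurable v).norm.aemeasurable).aestronglyMeasurable
  have hSb : ∀ᵐ z ∂μ, ∀ y, S z y ≤ 2 * C * (1 + ‖u z‖ + ‖y‖) ^ (σ - 1) := by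
    filter_upwards [hb] with z hz y
    refine div_le_of_le_mul₀ (norm_nonneg _) (by positivity) ?_
    have h1 := (hz (u z) y).2
    have h2 : |g z (u z) y| ≤ C * (1 + ‖u z‖ + ‖y‖) ^ (σ - 1) * ‖y‖ := by
      refine ((g z (u z)).le_opNorm y).trans ?_
      gcongr
      exact ((hz (u z) y).1).trans (mul_le_mul_of_nonneg_left (Real.rpow_le_rpow (by positivity)
        (by linarith [norm_nonneg y]) hσ1.le) hC)
    calc |R z y| ≤ |G z (u z + y) - G z (u z)| + |g z (u z) y| := abs_sub _ _
      _ ≤ _ := by linarith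
  set K : ℝ := (2 * C) ^ τ * 2 ^ σ with hKdef
  have hK : 0 ≤ K := by positivity
  have hSτ : ∀ᵐ z ∂μ, ∀ y, S z y ^ τ ≤ K * (1 + ‖u z‖) ^ σ + K * ‖y‖ ^ σ := by
    filter_upwards [hSb] with z hz y
    have h1 : S z y ^ τ ≤ (2 * C) ^ τ * (1 + ‖u z‖ + ‖y‖) ^ σ := by
      refine (Real.rpow_le_rpow (hS0 z y) (hz y) hτ0.le).trans (le_of_eq ?_)
      rw [Real.mul_rpow (by positivity) (by positivity), ← Real.rpow_mul (by positivity)]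
      congr 2
      rw [hτ]
      field_simp
    have h2 : (1 + ‖u z‖ + ‖y‖) ^ σ ≤ 2 ^ σ * ((1 + ‖u z‖) ^ σ + ‖y‖ ^ σ) := by
      have h3 : 1 + ‖u z‖ + ‖y‖ ≤ 2 * max (1 + ‖u z‖) ‖y‖ := by
        linarith [le_max_left (1 + ‖u z‖) ‖y‖, le_max_right (1 + ‖u z‖) ‖y‖]
      refine (Real.rpow_le_rpow (by positivity) h3 hσ0.le).trans ?_
      rw [Real.mul_rpow (by positivity) (by positivity)]
      gcongr
      rcases le_total (1 + ‖u z‖) ‖y‖ with h4 | h4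
      · rw [max_eq_right h4]
        have : 0 ≤ (1 + ‖u z‖) ^ σ := by positivity
        linarith
      · rw [max_eq_left h4]
        have : 0 ≤ ‖y‖ ^ σ := by positivity
        linarith
    calc S z y ^ τ ≤ (2 * C) ^ τ * (1 + ‖u z‖ + ‖y‖) ^ σ := h1
      _ ≤ (2 * C) ^ τ * (2 ^ σ * ((1 + ‖u z‖) ^ σ + ‖y‖ ^ σ)) := by gcongr
      _ = _ := by rw [hKdef]; ring
  have hbi : Integrable (fun z => K * (1 + ‖u z‖) ^ σ) μ :=
    (integrable_one_add_norm_rpow hσ0 (Lp.memLp u)).const_mul K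
  have hSm' : ∀ v : Lp E (ENNReal.ofReal σ) μ, AEStronglyMeasurable (fun z => S z (v z) ^ τ) μ :=
    fun v => ((hSm v).aemeasurable.pow_const τ).aestronglyMeasurable
  have hS0' : ∀ z y, 0 ≤ S z y ^ τ := fun z y => Real.rpow_nonneg (hS0 z y) _
  have hlim : Tendsto (fun v : Lp E (ENNReal.ofReal σ) μ => ∫ z, S z (v z) ^ τ ∂μ)
      (𝓝 0) (𝓝 0) := by
    refine tendsto_integral_of_dominated (Q := fun z y => S z y ^ τ) hσ hbi hSm' hS0' ?_ hSτ
    filter_upwards [h.deriv] with z hz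
    have h1 := hasFDerivAt_iff_isLittleO_nhds_zero.1 (hz (u z))
    have h2 : Tendsto (S z) (𝓝 0) (𝓝 0) := by
      have := h1.norm_norm.tendsto_div_nhds_zero
      exact this
    have := h2.rpow_const (p := τ) (Or.inr hτ0.le)
    rwa [Real.zero_rpow hτ0.ne'] at this
  have hlim' := hlim.rpow_const (p := 1 / τ) (Or.inr (by positivity))
  rw [Real.zero_rpow (by positivity)] at hlim'
  rw [hasFDerivAt_iff_isLittleO_nhds_zero]
  refine Asymptotics.IsLittleO.of_bound fun c hc => ?_
  filter_upwards [hlim'.eventually (gt_mem_nhds hc)] with v hv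
  have hSL : MemLp (fun z => S z (v z)) (ENNReal.ofReal τ) μ := by
    rw [← integrable_norm_rpow_iff (hSm v) (by simpa using hτ0) ENNReal.ofReal_ne_top,
      ENNReal.toReal_ofReal hτ0.le]
    have hi : Integrable (fun z => ‖v z‖ ^ σ) μ := by
      have := (Lp.memLp v).integrable_norm_rpow (by simpa using hσ0) ENNReal.ofReal_ne_top
      rwa [ENNReal.toReal_ofReal hσ0.le] at this
    refine (hbi.add (hi.const_mul K)).mono ?_ ?_
    · exact ((hSm v).norm.aemeasurable.pow_const τ).aestronglyMeasurable
    · filter_upwards [hSτ] with z hz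
      rw [Real.norm_of_nonneg (hS0 _ _), Real.norm_of_nonneg (hS0' _ _)]
      exact (hz _).trans (le_abs_self _)
  have hsum : MemLp (fun z => u z + v z) (ENNReal.ofReal σ) μ := (Lp.memLp u).add (Lp.memLp v)
  have hval : (∫ z, G z ((u + v : Lp E (ENNReal.ofReal σ) μ) z) ∂μ) - (∫ z, G z (u z) ∂μ) - L v =
      ∫ z, R z (v z) ∂μ := by
    have e1 : ∫ z, G z ((u + v : Lp E (ENNReal.ofReal σ) μ) z) ∂μ = ∫ z, G z (u z + v z) ∂μ := by
      refine integral_congr_ae ?_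
      filter_upwards [Lp.coeFn_add u v] with z hz
      rw [hz, Pi.add_apply]
    rw [e1, hLv, ← integral_sub (h.integrable hσ hsum) (h.integrable hσ (Lp.memLp u))]
    exact (integral_sub ((h.integrable hσ hsum).sub (h.integrable hσ (Lp.memLp u)))
      (h.integrable_deriv hσ (Lp.memLp u) (Lp.memLp v))).symm
  rw [hval]
  have hvn : (∫ z, ‖v z‖ ^ σ ∂μ) ^ (1 / σ) = ‖v‖ := by
    rw [← Lp.norm_rpow_eq_integral hσ0, ← Real.rpow_mul (norm_nonneg _),
      mul_one_div_cancel hσ0.ne', Real.rpow_one]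
  have hH := integral_mul_le_Lp_mul_Lq_of_nonneg hconj
    (Eventually.of_forall fun z => hS0 z (v z)) (Eventually.of_forall fun z => norm_nonneg (v z))
    hSL (Lp.memLp v).norm
  rw [hvn] at hH
  calc ‖∫ z, R z (v z) ∂μ‖ ≤ ∫ z, ‖R z (v z)‖ ∂μ := norm_integral_le_integral_norm _
    _ = ∫ z, S z (v z) * ‖v z‖ ∂μ :=
      integral_congr_ae (Eventually.of_forall fun z => hSR z (v z))
    _ ≤ (∫ z, S z (v z) ^ τ ∂μ) ^ (1 / τ) * ‖v‖ := hH
    _ ≤ c * ‖v‖ := by gcongr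

end IsIntegrand

/-! ### Pointwise consequences of the monotonicity condition -/

/-- The pointwise conditions on `k = f(z, ·)`: it vanishes at `0`, has the sign of its argument, is
`C¹` off `0`, and `(p-1) k(x) x ≤ k'(x) x²`. -/
structure IsPowerMonotone (p : ℝ) (k : ℝ → ℝ) : Prop where
  zero : k 0 = 0
  contDiff : ContDiffOn ℝ 1 k {0}ᶜ
  mono : ∀ x : ℝ, x ≠ 0 →
    0 < (p - 1) * (k x * x) ∧ (p - 1) * (k x * x) ≤ deriv k x * x ^ 2

namespace IsPowerMonotone

variable {p : ℝ} {k : ℝ → ℝ}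

theorem mul_pos (h : IsPowerMonotone p k) (hp : 1 < p) {x : ℝ} (hx : x ≠ 0) : 0 < k x * x :=
  pos_of_mul_pos_right (h.mono x hx).1 (by linarith)

theorem mul_nonneg (h : IsPowerMonotone p k) (hp : 1 < p) (x : ℝ) : 0 ≤ k x * x := by
  rcases eq_or_ne x 0 with rfl | hx
  · simp
  · exact (h.mul_pos hp hx).le

theorem abs_mul_abs (h : IsPowerMonotone p k) (hp : 1 < p) (x : ℝ) : |k x| * |x| = k x * x := by
  rw [← abs_mul, abs_of_nonneg (h.mul_nonneg hp x)]

theorem hasDerivAt (h : IsPowerMonotone p k) {x : ℝ} (hx : x ≠ 0) :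
    HasDerivAt k (deriv k x) x :=
  ((h.contDiff.differentiableOn one_ne_zero).differentiableAt
    (isOpen_compl_singleton.mem_nhds hx)).hasDerivAt

/-- With `y = tx`, the derivative is a positive multiple of `k'(y)y² - (p-1)k(y)y`. Working along
rays treats both signs of `x` at once. -/
theorem monotoneOn_ray (h : IsPowerMonotone p k) {x : ℝ} (hx : x ≠ 0) :
    MonotoneOn (fun t : ℝ => k (t * x) * x * t ^ (-(p - 1))) (Ioi 0) := by
  have hd : ∀ t ∈ Ioi (0 : ℝ), HasDerivAt (fun t : ℝ => k (t * x) * x * t ^ (-(p - 1)))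
      (deriv k (t * x) * x * x * t ^ (-(p - 1)) +
        k (t * x) * x * (-(p - 1) * t ^ (-(p - 1) - 1))) t := by
    intro t ht
    have h0 : t * x ≠ 0 := mul_ne_zero (ne_of_gt ht) hx
    have h1 : HasDerivAt (fun t : ℝ => t * x) x t := by simpa using (hasDerivAt_id t).mul_const x
    have h2 := ((h.hasDerivAt h0).comp t h1).mul_const x
    exact h2.mul (Real.hasDerivAt_rpow_const (Or.inl (ne_of_gt ht)))
  refine monotoneOn_of_deriv_nonneg (convex_Ioi 0)
    (fun t ht => (hd t ht).continuousAt.continuousWithinAt)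
    (fun t ht => ?_) fun t ht => ?_
  · rw [interior_Ioi] at ht
    exact (hd t ht).differentiableAt.differentiableWithinAt
  · rw [interior_Ioi] at ht
    rw [(hd t ht).deriv]
    have ht0 : 0 < t := ht
    have h1 := (h.mono (t * x) (mul_ne_zero ht0.ne' hx)).2
    have h2 : t ^ (-(p - 1)) = t ^ (-(p - 1) - 1) * t := by
      rw [← Real.rpow_add_one ht0.ne']
      ring_nf
    have h3 : 0 < t ^ (-(p - 1) - 1) := Real.rpow_pos_of_pos ht0 _
    rw [h2]
    have h4 : deriv k (t * x) * x * x * (t ^ (-(p - 1) - 1) * t) +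
        k (t * x) * x * (-(p - 1) * t ^ (-(p - 1) - 1)) =
        t ^ (-(p - 1) - 1) / t * (deriv k (t * x) * (t * x) ^ 2 - (p - 1) * (k (t * x) * (t * x)))
        := by
      field_simp
      ring
    rw [h4]
    exact _root_.mul_nonneg (by positivity) (by linarith)

theorem le_of_le_one (h : IsPowerMonotone p k) {t : ℝ} (ht : 0 < t) (ht1 : t ≤ 1) (x : ℝ) :
    k (t * x) * x ≤ t ^ (p - 1) * (k x * x) := by
  rcases eq_or_ne x 0 with rfl | hx
  · simp
  have h1 := h.monotoneOn_ray hx (mem_Ioi.2 ht) (mem_Ioi.2 one_pos) ht1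
  simp only [one_mul, Real.one_rpow, mul_one] at h1
  rw [Real.rpow_neg ht.le, ← div_eq_mul_inv, div_le_iff₀ (by positivity)] at h1
  linarith

theorem le_of_one_le (h : IsPowerMonotone p k) {t : ℝ} (ht1 : 1 ≤ t) (x : ℝ) :
    t ^ (p - 1) * (k x * x) ≤ k (t * x) * x := by
  rcases eq_or_ne x 0 with rfl | hx
  · simp
  have ht : 0 < t := by linarith
  have h1 := h.monotoneOn_ray hx (mem_Ioi.2 one_pos) (mem_Ioi.2 ht) ht1
  simp only [one_mul, Real.one_rpow, mul_one] at h1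
  rw [Real.rpow_neg ht.le, ← div_eq_mul_inv, le_div_iff₀ (by positivity)] at h1
  linarith

/-- For `|x| ≥ 1` the one-sided growth bound is two-sided because `k(x)x ≥ 0`. For `|x| ≤ 1`
monotonicity along the ray compares `x` with `x/|x|`, which produces the power `|x|^(p-1)`. -/
theorem abs_le (h : IsPowerMonotone p k) (hp : 1 < p) {c s σ : ℝ} (hs : s ≤ σ) (hσ : 0 < σ)
    (hc : ∀ x, k x * x ≤ c * (1 + |x| ^ s)) (x : ℝ) :
    |k x| ≤ 2 * c * (|x| ^ (p - 1) + |x| ^ (σ - 1)) := by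
  have hc0 : 0 < c := by
    have h1 := h.mul_pos hp one_ne_zero
    have h2 := hc 1
    norm_num at h1 h2
    linarith
  rcases eq_or_ne x 0 with rfl | hx
  · rw [h.zero, abs_zero]
    positivity
  have hx0 : 0 < |x| := abs_pos.2 hx
  rcases le_total 1 |x| with h1 | h1
  · have h2 : |k x| * |x| ≤ 2 * c * |x| ^ (σ - 1) * |x| := by
      rw [h.abs_mul_abs hp, mul_assoc, ← Real.rpow_add_one hx0.ne', sub_add_cancel]
      have h3 : |x| ^ s ≤ |x| ^ σ := Real.rpow_le_rpow_of_exponent_le h1 hs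
      have h4 : 1 ≤ |x| ^ σ := Real.one_le_rpow h1 hσ.le
      nlinarith [hc x]
    have h3 := le_of_mul_le_mul_right h2 hx0
    have h4 : 0 ≤ 2 * c * |x| ^ (p - 1) := by positivity
    linarith
  · obtain ⟨e, he⟩ : ∃ e, e = x / |x| := ⟨_, rfl⟩
    have hex : |x| * e = x := by rw [he]; field_simp
    have hen : |e| = 1 := by rw [he, abs_div, abs_abs, div_self hx0.ne']
    have h2 := h.le_of_le_one hx0 h1 e
    rw [hex] at h2
    have h5 : k e * e ≤ 2 * c := by
      have := hc e
      rw [hen, Real.one_rpow] at this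
      linarith
    have h6 : k x * e = |k x| := by
      rw [he, ← mul_div_assoc, ← h.abs_mul_abs hp, mul_div_assoc, div_self hx0.ne', mul_one]
    rw [h6] at h2
    have h7 : |x| ^ (p - 1) * (k e * e) ≤ |x| ^ (p - 1) * (2 * c) := by gcongr
    have h8 : 0 ≤ 2 * c * |x| ^ (σ - 1) := by positivity
    linarith

theorem continuous (h : IsPowerMonotone p k) (hp : 1 < p) {C σ : ℝ} (hσ : 1 < σ)
    (hC : ∀ x, |k x| ≤ C * (|x| ^ (p - 1) + |x| ^ (σ - 1))) : Continuous k := by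
  rw [continuous_iff_continuousAt]
  intro x
  rcases eq_or_ne x 0 with rfl | hx
  · rw [ContinuousAt, h.zero]
    have h1 : ∀ e : ℝ, 0 < e → Tendsto (fun x : ℝ => |x| ^ e) (𝓝 0) (𝓝 0) := by
      intro e he
      have := (continuous_abs.tendsto (0 : ℝ)).rpow_const (p := e) (Or.inr he.le)
      simpa [Real.zero_rpow he.ne'] using this
    have h2 := ((h1 (p - 1) (by linarith)).add (h1 (σ - 1) (by linarith))).const_mul C
    rw [add_zero, mul_zero] at h2
    exact squeeze_zero_norm hC h2
  · exact (h.hasDerivAt hx).continuousAt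

end IsPowerMonotone

section Primitive

variable {p : ℝ} {k : ℝ → ℝ}

theorem hasDerivAt_primitive (hk : Continuous k) (x : ℝ) :
    HasDerivAt (fun x => ∫ s in (0 : ℝ)..x, k s) (k x) x :=
  intervalIntegral.integral_hasDerivAt_right (hk.intervalIntegrable _ _)
    hk.aestronglyMeasurable.stronglyMeasurableAtFilter hk.continuousAt

theorem hasDerivAt_primitive_ray (hk : Continuous k) (x t : ℝ) :
    HasDerivAt (fun t : ℝ => ∫ s in (0 : ℝ)..(t * x), k s) (k (t * x) * x) t := by
  have h1 : HasDerivAt (fun t : ℝ => t * x) x t := by simpa using (hasDerivAt_id t).mul_const x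
  exact (hasDerivAt_primitive hk (t * x)).comp t h1

theorem IsPowerMonotone.primitive_nonneg (h : IsPowerMonotone p k) (hp : 1 < p)
    (hk : Continuous k) (x : ℝ) : 0 ≤ ∫ s in (0 : ℝ)..x, k s := by
  have hm : MonotoneOn (fun t : ℝ => ∫ s in (0 : ℝ)..(t * x), k s) (Icc 0 1) := by
    refine monotoneOn_of_deriv_nonneg (convex_Icc 0 1)
      (fun t _ => (hasDerivAt_primitive_ray hk x t).continuousAt.continuousWithinAt)
      (fun t _ => (hasDerivAt_primitive_ray hk x t).differentiableAt.differentiableWithinAt)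
      fun t ht => ?_
    rw [interior_Icc] at ht
    rw [(hasDerivAt_primitive_ray hk x t).deriv]
    have := h.mul_nonneg hp (t * x)
    exact nonneg_of_mul_nonneg_right (b := k (t * x) * x) (by linarith) ht.1
  have := hm (left_mem_Icc.2 zero_le_one) (right_mem_Icc.2 zero_le_one) zero_le_one
  simpa using this

/-- Comparison of the primitive along a ray with a `p`-homogeneous function. -/
theorem IsPowerMonotone.primitive_sub_le (h : IsPowerMonotone p k) (hp : 1 < p)
    (hk : Continuous k) {t : ℝ} (ht : 0 ≤ t) (x : ℝ) :
    (∫ s in (0 : ℝ)..x, k s) - (∫ s in (0 : ℝ)..(t * x), k s) ≤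
      (1 - t ^ p) / p * (k x * x) := by
  have hp0 : p ≠ 0 := by positivity
  -- `H` decreases on `[0,1]` and increases afterwards, so its minimum is at `t = 1`.
  set H : ℝ → ℝ := fun t => (∫ s in (0 : ℝ)..(t * x), k s) - t ^ p / p * (k x * x) with hH
  have hd : ∀ t, HasDerivAt H (k (t * x) * x - t ^ (p - 1) * (k x * x)) t := by
    intro t
    have h1 := ((Real.hasDerivAt_rpow_const (x := t) (p := p) (Or.inr hp.le)).div_const p).mul_const
      (k x * x)
    rw [mul_div_assoc, mul_div_cancel₀ _ hp0] at h1
    exact (hasDerivAt_primitive_ray hk x t).sub h1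
  have hc : Continuous H := continuous_iff_continuousAt.2 fun t => (hd t).continuousAt
  have hle : H 1 ≤ H t := by
    rcases le_total t 1 with h1 | h1
    · have ha : AntitoneOn H (Icc 0 1) := by
        refine antitoneOn_of_deriv_nonpos (convex_Icc 0 1) hc.continuousOn
          (fun t _ => (hd t).differentiableAt.differentiableWithinAt) fun t ht => ?_
        rw [interior_Icc] at ht
        rw [(hd t).deriv]
        linarith [h.le_of_le_one ht.1 ht.2.le x]
      exact ha ⟨ht, h1⟩ (right_mem_Icc.2 zero_le_one) h1
    · have ha : MonotoneOn H (Ici 1) := by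
        refine monotoneOn_of_deriv_nonneg (convex_Ici 1) hc.continuousOn
          (fun t _ => (hd t).differentiableAt.differentiableWithinAt) fun t ht => ?_
        rw [interior_Ici] at ht
        rw [(hd t).deriv]
        linarith [h.le_of_one_le (le_of_lt ht) x]
      exact ha self_mem_Ici h1 h1
  simp only [hH, one_mul, Real.one_rpow] at hle
  have : (1 - t ^ p) / p * (k x * x) = 1 / p * (k x * x) - t ^ p / p * (k x * x) := by ring
  linarith

theorem IsPowerMonotone.primitive_le (h : IsPowerMonotone p k) (hp : 1 < p) (hk : Continuous k)
    {C σ : ℝ} (hσ : 1 < σ) (hC : ∀ x, |k x| ≤ C * (|x| ^ (p - 1) + |x| ^ (σ - 1))) (x : ℝ) :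
    (∫ s in (0 : ℝ)..x, k s) ≤ C * (|x| ^ p + |x| ^ σ) := by
  -- The case `t = 0` of the ray comparison bounds the primitive by `k(x)x/p`.
  have h1 := h.primitive_sub_le hp hk le_rfl x
  rw [zero_mul, intervalIntegral.integral_same, sub_zero,
    Real.zero_rpow (by positivity), sub_zero] at h1
  have h2 : 1 / p * (k x * x) ≤ 1 * (k x * x) := by
    gcongr
    · exact h.mul_nonneg hp x
    · exact (div_le_one (by linarith)).2 hp.le
  have h3 : |k x| * |x| ≤ C * (|x| ^ (p - 1) + |x| ^ (σ - 1)) * |x| := by gcongr; exact hC x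
  have h4 : ∀ e : ℝ, 1 < e → |x| ^ (e - 1) * |x| = |x| ^ e := by
    intro e he
    rcases eq_or_ne x 0 with rfl | hx
    · simp [Real.zero_rpow (by linarith : e ≠ 0)]
    · rw [← Real.rpow_add_one (abs_pos.2 hx).ne', sub_add_cancel]
  rw [h.abs_mul_abs hp, mul_assoc, add_mul, h4 p hp, h4 σ hσ] at h3
  linarith

theorem IsPowerMonotone.le_primitive (h : IsPowerMonotone p k) (hp : 1 < p) (hk : Continuous k)
    {M R : ℝ} (hM : 0 ≤ M) (hR : 0 < R)
    (hs : ∀ x : ℝ, R ≤ |x| → M ≤ (∫ s in (0 : ℝ)..x, k s) / |x| ^ p) (x : ℝ) :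
    M * |x| ^ p - M * R ^ p ≤ ∫ s in (0 : ℝ)..x, k s := by
  rcases le_total R |x| with h1 | h1
  · have hx : 0 < |x| := by linarith
    have := hs x h1
    rw [le_div_iff₀ (by positivity)] at this
    have h2 : 0 ≤ M * R ^ p := by positivity
    linarith
  · have h2 := h.primitive_nonneg hp hk x
    have h3 : M * |x| ^ p ≤ M * R ^ p := by gcongr
    linarith

end Primitive

/-! ### Growth exponent and measurability of the reaction -/

/-- If `p < N`, the critical exponent itself serves, so critical growth is allowed; otherwise any
exponent above `p` and `s` does. -/
theorem exists_sobolev_exponent {N : ℕ} (hN : 1 ≤ N) {p s : ℝ} (hp : 1 < p)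
    (hs : (s : EReal) ≤ criticalExponent N p) :
    ∃ σ : ℝ, p < σ ∧ s ≤ σ ∧ 1 / p - 1 / N ≤ 1 / σ := by
  have hN0 : (0 : ℝ) < N := by exact_mod_cast hN
  have hp0 : 0 < p := by linarith
  unfold criticalExponent at hs
  split_ifs at hs with h
  · have h0 : 0 < (N : ℝ) - p := by linarith
    refine ⟨N * p / (N - p), ?_, EReal.coe_le_coe_iff.1 hs, le_of_eq ?_⟩
    · rw [lt_div_iff₀ h0]
      nlinarith
    · field_simp
  · refine ⟨max s p + 1, by linarith [le_max_right s p], by linarith [le_max_left s p], ?_⟩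
    have h1 : 0 < max s p + 1 := by linarith [le_max_right s p]
    have h2 : 1 / p ≤ 1 / N := one_div_le_one_div_of_le hN0 (not_lt.1 h)
    have h3 : 0 < 1 / (max s p + 1) := by positivity
    linarith

/-- The properties of the reaction used below, with `σ` a non-supercritical exponent. -/
structure IsReaction {N : ℕ} (Ω : Set (Eucl N)) (p σ C : ℝ) (f : Eucl N → ℝ → ℝ) : Prop where
  measurable : AEMeasurable (fun w : Eucl N × ℝ => f w.1 w.2) ((volume.restrict Ω).prod volume)
  regular : ∀ᵐ z ∂(volume.restrict Ω), IsPowerMonotone p (f z) ∧ Continuous (f z) ∧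
    ∀ x, |f z x| ≤ C * (|x| ^ (p - 1) + |x| ^ (σ - 1))
  superlinear : ∀ M : ℝ, ∃ R > 0, ∀ᵐ z ∂(volume.restrict Ω), ∀ x : ℝ, R ≤ |x| →
    M ≤ primitiveF f z x / |x| ^ p

theorem ReactionHyp.exists_isReaction {N : ℕ} (hN : 1 ≤ N) {Ω : Set (Eucl N)} {p q r : ℝ}
    (hp : 1 < p) {f : Eucl N → ℝ → ℝ} (hf : ReactionHyp Ω p q r f) :
    ∃ σ C : ℝ, p < σ ∧ 0 ≤ C ∧ 1 / p - 1 / N ≤ 1 / σ ∧ IsReaction Ω p σ C f := by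
  obtain ⟨s, c, hs, hc⟩ := hf.growth
  obtain ⟨σ, hpσ, hsσ, hσ⟩ := exists_sobolev_exponent hN hp hs
  refine ⟨σ, |2 * c|, hpσ, abs_nonneg _, hσ, hf.measurable, ?_, hf.superlinear⟩
  filter_upwards [hf.zero, hf.contDiff, hf.monotone, hc] with z h0 h1 h2 h3
  have h : IsPowerMonotone p (f z) := ⟨h0, h1, h2⟩
  have hb := h.abs_le hp hsσ (by linarith) h3
  refine ⟨h, h.continuous hp (by linarith) hb, fun x => (hb x).trans ?_⟩
  gcongr
  exact le_abs_self _

/-- The integral with a variable endpoint is a difference of parameter integrals of indicators of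
measurable sets, and these are measurable by Fubini. -/
theorem stronglyMeasurable_primitive {α : Type*} [MeasurableSpace α] {g : α × ℝ → ℝ}
    (hg : Measurable g) :
    StronglyMeasurable fun w : α × ℝ => ∫ s in (0 : ℝ)..w.2, g (w.1, s) := by
  have h1 : ∀ S : Set ((α × ℝ) × ℝ), MeasurableSet S →
      StronglyMeasurable fun w : α × ℝ => ∫ s, S.indicator (fun y => g (y.1.1, y.2)) (w, s) := by
    intro S hS
    refine StronglyMeasurable.integral_prod_right' (StronglyMeasurable.indicator ?_ hS)
    exact (hg.comp ((measurable_fst.comp measurable_fst).prodMk measurable_snd)).stronglyMeasurable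
  have h2 : MeasurableSet {y : (α × ℝ) × ℝ | 0 < y.2 ∧ y.2 ≤ y.1.2} :=
    (measurableSet_lt measurable_const measurable_snd).inter
      (measurableSet_le measurable_snd (measurable_snd.comp measurable_fst))
  have h3 : MeasurableSet {y : (α × ℝ) × ℝ | y.1.2 < y.2 ∧ y.2 ≤ 0} :=
    (measurableSet_lt (measurable_snd.comp measurable_fst) measurable_snd).inter
      (measurableSet_le measurable_snd measurable_const)
  convert (h1 _ h2).sub (h1 _ h3) using 1
  ext w
  rw [intervalIntegral, ← integral_indicator measurableSet_Ioc,
    ← integral_indicator measurableSet_Ioc]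
  rfl

/-- For a.e. `z`, passing to a Borel version changes `f(z,·)` only on a null set, which the integral
does not see. -/
theorem AEMeasurable.aestronglyMeasurable_primitive {α : Type*} [MeasurableSpace α]
    {μ : Measure α} [SFinite μ] {f : α → ℝ → ℝ}
    (hf : AEMeasurable (fun w : α × ℝ => f w.1 w.2) (μ.prod volume)) {v : α → ℝ}
    (hv : AEStronglyMeasurable v μ) :
    AEStronglyMeasurable (fun z => ∫ s in (0 : ℝ)..(v z), f z s) μ := by
  obtain ⟨g, hg, hfg⟩ := hf
  have h1 := (stronglyMeasurable_primitive hg).comp_measurable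
    (measurable_id.prodMk hv.stronglyMeasurable_mk.measurable)
  refine ⟨_, h1, ?_⟩
  filter_upwards [Measure.ae_ae_of_ae_prod hfg, hv.ae_eq_mk] with z h2 h3
  simp only [Function.comp_apply, id]
  rw [← h3]
  refine intervalIntegral.integral_congr_ae ?_
  filter_upwards [h2] with s hs _ using hs

/-- A Borel version of `f` cannot be substituted directly, since it may differ from `f` on the graph
of `v`, a null set. By continuity in the second variable, `f(z,v(z))` is instead a limit of
difference quotients of the primitive. -/
theorem AEMeasurable.aestronglyMeasurable_superposition {α : Type*} [MeasurableSpace α]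
    {μ : Measure α} [SFinite μ] {f : α → ℝ → ℝ}
    (hf : AEMeasurable (fun w : α × ℝ => f w.1 w.2) (μ.prod volume))
    (hc : ∀ᵐ z ∂μ, Continuous (f z)) {v : α → ℝ} (hv : AEStronglyMeasurable v μ) :
    AEStronglyMeasurable (fun z => f z (v z)) μ := by
  set t : ℕ → ℝ := fun n => 1 / ((n : ℝ) + 1)
  have ht : Tendsto t atTop (𝓝[≠] 0) :=
    tendsto_nhdsWithin_iff.2 ⟨tendsto_one_div_add_atTop_nhds_zero_nat,
      Eventually.of_forall fun n => (Nat.one_div_pos_of_nat).ne'⟩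
  refine aestronglyMeasurable_of_tendsto_ae atTop
    (f := fun n z => (t n)⁻¹ • ((∫ s in (0 : ℝ)..(v z + t n), f z s) -
      ∫ s in (0 : ℝ)..(v z), f z s)) (fun n => ?_) ?_
  · exact ((hf.aestronglyMeasurable_primitive (hv.add aestronglyMeasurable_const)).sub
      (hf.aestronglyMeasurable_primitive hv)).const_mul _
  · filter_upwards [hc] with z hz
    exact (hasDerivAt_iff_tendsto_slope_zero.1 (hasDerivAt_primitive hz (v z))).comp ht

theorem IsReaction.isIntegrand {N : ℕ} {Ω : Set (Eucl N)} [IsFiniteMeasure (volume.restrict Ω)]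
    {p σ C : ℝ} {f : Eucl N → ℝ → ℝ} (hf : IsReaction Ω p σ C f) (hp : 1 < p) (hpσ : p < σ)
    (hC : 0 ≤ C) :
    IsIntegrand (volume.restrict Ω) σ (primitiveF f)
      (fun z x => ContinuousLinearMap.toSpanSingleton ℝ (f z x)) where
  meas v hv := hf.measurable.aestronglyMeasurable_primitive hv
  meas_deriv v hv := by
    have h := hf.measurable.aestronglyMeasurable_superposition
      (hf.regular.mono fun z hz => hz.2.1) hv
    exact (LinearMap.continuous_of_finiteDimensional
      (ContinuousLinearMap.toSpanSingletonLE ℝ ℝ ℝ).toLinearMap).comp_aestronglyMeasurable h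
  zero := Eventually.of_forall fun z => by simp [primitiveF]
  deriv := by
    filter_upwards [hf.regular] with z hz x
    exact (hasDerivAt_primitive hz.2.1 x).hasFDerivAt
  bound := by
    refine ⟨2 * C, by positivity, ?_⟩
    filter_upwards [hf.regular] with z hz x
    rw [ContinuousLinearMap.norm_toSpanSingleton, Real.norm_eq_abs, Real.norm_eq_abs]
    refine (hz.2.2 x).trans ?_
    have h1 : |x| ^ (p - 1) ≤ (1 + |x|) ^ (σ - 1) :=
      (Real.rpow_le_rpow (abs_nonneg x) (by linarith) (by linarith)).trans
        (Real.rpow_le_rpow_of_exponent_le (by linarith [abs_nonneg x]) (by linarith))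
    have h2 : |x| ^ (σ - 1) ≤ (1 + |x|) ^ (σ - 1) :=
      Real.rpow_le_rpow (abs_nonneg x) (by linarith) (by linarith)
    calc C * (|x| ^ (p - 1) + |x| ^ (σ - 1)) ≤
        C * ((1 + |x|) ^ (σ - 1) + (1 + |x|) ^ (σ - 1)) := by gcongr
      _ = _ := by ring

theorem isIntegrand_norm_rpow {N : ℕ} {α : Type*} [MeasurableSpace α] {μ : Measure α}
    {w : α → ℝ} (hw : MemLp w ⊤ μ) {e σ : ℝ} (he : 1 < e) (heσ : e ≤ σ) :
    IsIntegrand μ σ (fun z (x : Eucl N) => w z * ‖x‖ ^ e)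
      (fun z x => w z • fderiv ℝ (fun x : Eucl N => ‖x‖ ^ e) x) where
  meas v hv := hw.1.mul (hv.norm.aemeasurable.pow_const e).aestronglyMeasurable
  meas_deriv v hv := hw.1.smul
    (((contDiff_norm_rpow he).continuous_fderiv one_ne_zero).comp_aestronglyMeasurable hv)
  zero := Eventually.of_forall fun z => by
    simp [Real.zero_rpow (by linarith : e ≠ 0)]
  deriv := Eventually.of_forall fun z x =>
    ((differentiable_norm_rpow he) x).hasFDerivAt.const_mul (w z)
  bound := by
    have h := ae_le_eLpNormEssSup (f := w) (μ := μ)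
    have hfin : eLpNormEssSup w μ ≠ ⊤ := by
      rw [← eLpNorm_exponent_top]; exact hw.2.ne
    refine ⟨(eLpNormEssSup w μ).toReal * e, by positivity, ?_⟩
    filter_upwards [h] with z hz x
    rw [norm_smul, norm_fderiv_norm_id_rpow x he, mul_assoc]
    have h1 : ‖w z‖ ≤ (eLpNormEssSup w μ).toReal := by
      rw [← toReal_enorm]
      exact ENNReal.toReal_mono hfin hz
    have h2 : ‖x‖ ^ (e - 1) ≤ (1 + ‖x‖) ^ (σ - 1) :=
      (Real.rpow_le_rpow (norm_nonneg x) (by linarith) (by linarith)).trans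
        (Real.rpow_le_rpow_of_exponent_le (by linarith [norm_nonneg x]) (by linarith))
    gcongr

theorem fderiv_norm_rpow_self {N : ℕ} (x : Eucl N) {e : ℝ} (he : 1 < e) :
    fderiv ℝ (fun x : Eucl N => ‖x‖ ^ e) x x = e * ‖x‖ ^ e := by
  rw [fderiv_norm_rpow x he]
  rcases eq_or_ne x 0 with rfl | hx
  · simp [Real.zero_rpow (by linarith : e ≠ 0)]
  · have h : ‖x‖ ^ e = ‖x‖ ^ (e - 2) * ‖x‖ ^ 2 := by
      rw [← Real.rpow_natCast, ← Real.rpow_add (norm_pos_iff.2 hx)]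
      norm_num
    simp only [smul_apply, innerSL_apply_apply, smul_eq_mul,
      real_inner_self_eq_norm_sq]
    rw [h]
    ring

/-! ### The energy along rays and its derivative -/

section Energy

variable {N : ℕ} {Ω : Set (Eucl N)} {p q σ C : ℝ} [Fact (1 ≤ ENNReal.ofReal p)]
  [Fact (1 ≤ ENNReal.ofReal σ)] {a : Eucl N → ℝ} {f : Eucl N → ℝ → ℝ}

theorem W0.grad_smul (t : ℝ) (u : W0 Ω p) :
    ((t • u).grad : Eucl N → Eucl N) =ᵐ[volume.restrict Ω] fun z => t • u.grad z :=
  Lp.coeFn_smul t u.grad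

theorem W0.fn_smul (t : ℝ) (u : W0 Ω p) :
    ((t • u).fn : Eucl N → ℝ) =ᵐ[volume.restrict Ω] fun z => t * u.fn z :=
  Lp.coeFn_smul t u.fn

theorem W0.norm_grad_smul {t : ℝ} (ht : 0 ≤ t) (u : W0 Ω p) : ‖(t • u).grad‖ = t * ‖u.grad‖ := by
  change ‖t • u.grad‖ = _
  rw [norm_smul, Real.norm_of_nonneg ht]

theorem W0.integral_grad_smul {t : ℝ} (ht : 0 ≤ t) (u : W0 Ω p) :
    ∫ z in Ω, a z * ‖(t • u).grad z‖ ^ q = t ^ q * ∫ z in Ω, a z * ‖u.grad z‖ ^ q := by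
  rw [← integral_const_mul]
  refine integral_congr_ae ?_
  filter_upwards [W0.grad_smul t u] with z hz
  rw [hz, norm_smul, Real.norm_of_nonneg ht, Real.mul_rpow ht (norm_nonneg _)]
  ring

theorem WeightHyp.integral_nonneg (ha : WeightHyp Ω a) (u : W0 Ω p) :
    0 ≤ ∫ z in Ω, a z * ‖u.grad z‖ ^ q := by
  refine integral_nonneg_of_ae ?_
  filter_upwards [ha.pos] with z hz
  have := norm_nonneg (u.grad z)
  simp only [Pi.zero_apply]
  positivity

theorem energy_smul {t : ℝ} (ht : 0 ≤ t) (u : W0 Ω p) :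
    energy Ω p q a f (t • u) = t ^ p / p * ‖u.grad‖ ^ p +
      t ^ q / q * (∫ z in Ω, a z * ‖u.grad z‖ ^ q) -
      ∫ z in Ω, primitiveF f z (t * u.fn z) := by
  rw [energy, W0.norm_grad_smul ht, W0.integral_grad_smul ht,
    Real.mul_rpow ht (norm_nonneg _)]
  congr 1
  · ring
  · refine integral_congr_ae ?_
    filter_upwards [W0.fn_smul t u] with z hz
    rw [hz]

theorem memLp_fn (T : W0 Ω p →L[ℝ] Lp ℝ (ENNReal.ofReal σ) (volume.restrict Ω))
    (hT : ∀ u, T u =ᵐ[volume.restrict Ω] u.fn) (u : W0 Ω p) :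
    MemLp u.fn (ENNReal.ofReal σ) (volume.restrict Ω) :=
  (memLp_congr_ae (hT u)).1 (Lp.memLp _)

variable [IsFiniteMeasure (volume.restrict Ω)]

/-- Chain rule: the gradient terms are integral functionals on `L^p` composed with the gradient map.
The reaction term can grow faster than `|x|^p`, so it is differentiated on `L^σ` and composed with
the embedding `T`. -/
theorem exists_hasFDerivAt_energy (hq : 1 < q) (hqp : q < p) (hpσ : p < σ) (hC : 0 ≤ C)
    (ha : WeightHyp Ω a) (hf : IsReaction Ω p σ C f)
    (T : W0 Ω p →L[ℝ] Lp ℝ (ENNReal.ofReal σ) (volume.restrict Ω))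
    (hT : ∀ u, T u =ᵐ[volume.restrict Ω] u.fn) (u : W0 Ω p) :
    ∃ L : W0 Ω p →L[ℝ] ℝ, HasFDerivAt (energy Ω p q a f) L u ∧
      L u = ‖u.grad‖ ^ p + (∫ z in Ω, a z * ‖u.grad z‖ ^ q) -
        ∫ z in Ω, f z (u.fn z) * u.fn z := by
  have hp : 1 < p := hq.trans hqp
  have h1 : IsIntegrand (volume.restrict Ω) p _ _ :=
    isIntegrand_norm_rpow (N := N) (memLp_top_const (1 : ℝ)) hp le_rfl
  have h2 : IsIntegrand (volume.restrict Ω) p _ _ :=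
    isIntegrand_norm_rpow (N := N) ha.memLp hq hqp.le
  have h3 := hf.isIntegrand hp hpσ hC
  obtain ⟨L1, hL1, hv1⟩ := h1.exists_hasFDerivAt hp (W0.gradL Ω p u)
  obtain ⟨L2, hL2, hv2⟩ := h2.exists_hasFDerivAt hp (W0.gradL Ω p u)
  obtain ⟨L3, hL3, hv3⟩ := h3.exists_hasFDerivAt (hp.trans hpσ) (T u)
  have hp0 : p ≠ 0 := by positivity
  have hq0 : q ≠ 0 := by positivity
  refine ⟨(1 / p) • (L1.comp (W0.gradL Ω p)) + (1 / q) • (L2.comp (W0.gradL Ω p)) -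
    L3.comp T, ?_, ?_⟩
  · have hd := (((hL1.comp u (W0.gradL Ω p).hasFDerivAt).const_mul (1 / p)).add
      ((hL2.comp u (W0.gradL Ω p).hasFDerivAt).const_mul (1 / q))).sub
      (hL3.comp u T.hasFDerivAt)
    refine hd.congr_of_eventuallyEq (Eventually.of_forall fun v => ?_)
    simp only [energy, Function.comp_apply, Pi.add_apply, Pi.sub_apply, W0.gradL_apply, one_mul]
    rw [Lp.norm_rpow_eq_integral (by linarith)]
    congr 1
    refine integral_congr_ae ?_
    filter_upwards [hT v] with z hz
    rw [hz]
  · have e1 : L1 (W0.gradL Ω p u) = p * ‖u.grad‖ ^ p := by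
      rw [hv1, Lp.norm_rpow_eq_integral (by linarith), ← integral_const_mul]
      refine integral_congr_ae (Eventually.of_forall fun z => ?_)
      simp only [one_smul, W0.gradL_apply]
      exact fderiv_norm_rpow_self _ hp
    have e2 : L2 (W0.gradL Ω p u) = q * ∫ z in Ω, a z * ‖u.grad z‖ ^ q := by
      rw [hv2, ← integral_const_mul]
      refine integral_congr_ae (Eventually.of_forall fun z => ?_)
      simp only [W0.gradL_apply, smul_apply, smul_eq_mul]
      rw [fderiv_norm_rpow_self _ hq]
      ring
    have e3 : L3 (T u) = ∫ z in Ω, f z (u.fn z) * u.fn z := by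
      rw [hv3]
      refine integral_congr_ae ?_
      filter_upwards [hT u] with z hz
      simp only [ContinuousLinearMap.toSpanSingleton_apply, smul_eq_mul]
      rw [hz, mul_comm]
    simp only [sub_apply, add_apply, smul_apply,
      ContinuousLinearMap.comp_apply, smul_eq_mul, e1, e2, e3]
    field_simp

/-- On a ray through a point of the Nehari manifold, the energy is largest at that point. -/
theorem energy_smul_le (hq : 1 < q) (hqp : q < p) (hpσ : p < σ) (hC : 0 ≤ C)
    (ha : WeightHyp Ω a) (hf : IsReaction Ω p σ C f)
    (T : W0 Ω p →L[ℝ] Lp ℝ (ENNReal.ofReal σ) (volume.restrict Ω))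
    (hT : ∀ u, T u =ᵐ[volume.restrict Ω] u.fn) {u : W0 Ω p}
    (hu : fderiv ℝ (energy Ω p q a f) u u = 0) {t : ℝ} (ht : 0 ≤ t) :
    energy Ω p q a f (t • u) ≤ energy Ω p q a f u := by
  have hp : 1 < p := hq.trans hqp
  have hσ : 1 < σ := hp.trans hpσ
  obtain ⟨L, hL, hLu⟩ := exists_hasFDerivAt_energy hq hqp hpσ hC ha hf T hT u
  rw [hL.fderiv, hLu] at hu
  have hI := hf.isIntegrand hp hpσ hC
  have hm := memLp_fn T hT u
  have hmt : MemLp (fun z => t * u.fn z) (ENNReal.ofReal σ) (volume.restrict Ω) := hm.const_mul t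
  have hi : Integrable (fun z => f z (u.fn z) * u.fn z) (volume.restrict Ω) := by
    refine (hI.integrable_deriv hσ hm hm).congr (Eventually.of_forall fun z => ?_)
    simp [mul_comm]
  have hF : (∫ z in Ω, primitiveF f z (u.fn z)) - ∫ z in Ω, primitiveF f z (t * u.fn z) ≤
      (1 - t ^ p) / p * ∫ z in Ω, f z (u.fn z) * u.fn z := by
    rw [← integral_sub (hI.integrable hσ hm) (hI.integrable hσ hmt), ← integral_const_mul]
    refine integral_mono_ae ((hI.integrable hσ hm).sub (hI.integrable hσ hmt))
      (hi.const_mul _) ?_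
    filter_upwards [hf.regular] with z hz
    exact hz.1.primitive_sub_le hp hz.2.1 ht _
  have hA := ha.integral_nonneg (q := q) u
  have h1 := energy_smul (q := q) (a := a) (f := f) zero_le_one u
  rw [one_smul, Real.one_rpow, Real.one_rpow] at h1
  simp only [one_mul] at h1
  rw [energy_smul ht, h1]
  set A := ∫ z in Ω, a z * ‖u.grad z‖ ^ q
  set D := ‖u.grad‖ ^ p
  set I := ∫ z in Ω, f z (u.fn z) * u.fn z
  have hI' : I = D + A := by linarith
  rw [hI'] at hF
  -- Bernoulli's inequality for the base `t^q` and the exponent `p/q ≥ 1`.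
  have hconv : (t ^ q - 1) / q ≤ (t ^ p - 1) / p := by
    have hb := one_add_mul_self_le_rpow_one_add (s := t ^ q - 1)
      (by linarith [Real.rpow_nonneg ht q]) (p := p / q) ((one_le_div (by linarith)).2 hqp.le)
    rw [add_sub_cancel, ← Real.rpow_mul ht, mul_div_cancel₀ _ (by linarith)] at hb
    rw [le_div_iff₀ (by linarith)]
    have e : (t ^ q - 1) / q * p = p / q * (t ^ q - 1) := by ring
    linarith
  have h2 := mul_le_mul_of_nonneg_right hconv hA
  have e1 : (1 - t ^ p) / p * (D + A) = 1 / p * D - t ^ p / p * D - (t ^ p - 1) / p * A := by ring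
  have e2 : (t ^ q - 1) / q * A = t ^ q / q * A - 1 / q * A := by ring
  linarith

end Energy

/-! ### The lower bound on a small sphere -/

/-- The gradient is small in `L¹` when its `L^q` norm with the weight `a` is small, uniformly on
bounded sets of `L^p`. -/
theorem exists_integral_norm_le {N : ℕ} {Ω : Set (Eucl N)} {p q : ℝ}
    [IsFiniteMeasure (volume.restrict Ω)] {a : Eucl N → ℝ} (ha : WeightHyp Ω a) (hq : 1 < q)
    (hqp : q < p) {ε : ℝ} (hε : 0 < ε) :
    ∃ K : ℝ, 0 ≤ K ∧ ∀ v : Lp (Eucl N) (ENNReal.ofReal p) (volume.restrict Ω), ‖v‖ ≤ 1 →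
      ∫ z in Ω, ‖v z‖ ≤ ε + K * ∫ z in Ω, a z * ‖v z‖ ^ q := by
  set μ := volume.restrict Ω with hμ
  have hp : 1 < p := hq.trans hqp
  have hp0 : 0 < p := by linarith
  have split : ∀ (m e x : ℝ), 0 < m → 1 < e → 0 ≤ x → x ≤ m + m ^ (1 - e) * x ^ e := by
    intro m e x hm he hx
    rcases le_total x m with h | h
    · have : 0 ≤ m ^ (1 - e) * x ^ e := by positivity
      linarith
    · have hx0 : 0 < x := by linarith
      have h1 : x = x ^ (1 - e) * x ^ e := by
        rw [← Real.rpow_add hx0]; simp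
      have h2 : x ^ (1 - e) ≤ m ^ (1 - e) :=
        Real.rpow_le_rpow_of_nonpos hm h (by linarith)
      have h3 : x ^ (1 - e) * x ^ e ≤ m ^ (1 - e) * x ^ e := by gcongr
      linarith
  obtain ⟨M, hM0, hM⟩ : ∃ M : ℝ, 0 < M ∧ M ^ (1 - p) < ε / 3 := by
    have h := (tendsto_rpow_neg_atTop (y := p - 1) (by linarith)).eventually
      (gt_mem_nhds (by positivity : 0 < ε / 3))
    obtain ⟨M, h1, h2⟩ := (h.and (eventually_gt_atTop 0)).exists
    exact ⟨M, h2, by simpa using h1⟩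
  have hV : 0 ≤ μ.real univ := measureReal_nonneg
  obtain ⟨m, hm0, hm⟩ : ∃ m : ℝ, 0 < m ∧ m * μ.real univ ≤ ε / 3 := by
    refine ⟨ε / 3 / (μ.real univ + 1), by positivity, ?_⟩
    rw [div_mul_eq_mul_div, div_le_iff₀ (by positivity)]
    nlinarith
  -- A soft indicator of `{n a ≤ 1}`: it is at least `1/2` there, and its integral tends to 0
  -- because `a > 0` a.e. On that set `‖v‖` is split at the large level `M`, the tail being
  -- controlled by the `L^p` bound; elsewhere it is split at the small level `m`, and `n a ≥ 1`
  -- brings in the weight.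
  set b : ℕ → Eucl N → ℝ := fun n z => 1 / (1 + n * |a z|) with hb
  have hbm : ∀ n, AEStronglyMeasurable (b n) μ := fun n =>
    (((ha.memLp.1.norm.aemeasurable.const_mul (n : ℝ)).const_add 1).const_div 1).aestronglyMeasurable
  have hb1 : ∀ n z, ‖b n z‖ ≤ 1 := by
    intro n z
    rw [Real.norm_of_nonneg (by positivity)]
    have : 0 ≤ (n : ℝ) * |a z| := by positivity
    exact (div_le_one (by positivity)).2 (by linarith)
  have hbi : ∀ n, Integrable (b n) μ := fun n =>
    (integrable_const (1 : ℝ)).mono (hbm n) (Eventually.of_forall fun z => by simpa using hb1 n z)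
  have hblim : Tendsto (fun n => ∫ z, b n z ∂μ) atTop (𝓝 0) := by
    have : Tendsto (fun n => ∫ z, b n z ∂μ) atTop (𝓝 (∫ _, (0 : ℝ) ∂μ)) := by
      refine tendsto_integral_of_dominated_convergence (fun _ => 1) hbm (integrable_const _)
        (fun n => Eventually.of_forall (hb1 n)) ?_
      filter_upwards [ha.pos] with z hz
      have h1 : Tendsto (fun n : ℕ => 1 + (n : ℝ) * |a z|) atTop atTop :=
        tendsto_atTop_add_const_left _ _
          (tendsto_natCast_atTop_atTop.atTop_mul_const (abs_pos.2 hz.ne'))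
      simpa [hb, Pi.inv_def] using h1.inv_tendsto_atTop
    simpa using this
  obtain ⟨n, hn⟩ : ∃ n, 2 * M * ∫ z, b n z ∂μ < ε / 3 := by
    have h := hblim.const_mul (2 * M)
    rw [mul_zero] at h
    exact (h.eventually (gt_mem_nhds (by positivity : 0 < ε / 3))).exists
  refine ⟨m ^ (1 - q) * n, by positivity, fun v hv => ?_⟩
  have hip : Integrable (fun z => ‖v z‖ ^ p) μ := by
    have := (Lp.memLp v).integrable_norm_rpow (by simpa using hp0) ENNReal.ofReal_ne_top
    rwa [ENNReal.toReal_ofReal hp0.le] at this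
  have hiq : Integrable (fun z => a z * ‖v z‖ ^ q) μ :=
    (isIntegrand_norm_rpow (N := N) ha.memLp hq hqp.le).integrable hp (Lp.memLp v)
  have hi1 : Integrable (fun z => ‖v z‖) μ :=
    ((Lp.memLp v).integrable (by simpa using hp.le)).norm
  have I1 : Integrable (fun z => m + m ^ (1 - q) * n * (a z * ‖v z‖ ^ q)) μ :=
    (integrable_const m).add (hiq.const_mul _)
  have I2 : Integrable (fun z => 2 * M * b n z + M ^ (1 - p) * ‖v z‖ ^ p) μ :=
    ((hbi n).const_mul _).add (hip.const_mul _)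
  have hint : ∫ z, ‖v z‖ ∂μ ≤ ∫ z, ((m + m ^ (1 - q) * n * (a z * ‖v z‖ ^ q)) +
      (2 * M * b n z + M ^ (1 - p) * ‖v z‖ ^ p)) ∂μ := by
    refine integral_mono_ae hi1 (I1.add I2) ?_
    filter_upwards [ha.pos] with z hz
    have hx := norm_nonneg (v z)
    have t1 : 0 ≤ m ^ (1 - q) * n * (a z * ‖v z‖ ^ q) := by positivity
    have t2 : 0 ≤ 2 * M * b n z := by positivity
    have t3 : 0 ≤ M ^ (1 - p) * ‖v z‖ ^ p := by positivity
    rcases le_total ((n : ℝ) * |a z|) 1 with h | h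
    · have h1 : 1 / 2 ≤ b n z :=
        one_div_le_one_div_of_le (by positivity) (by linarith)
      have h2 := split M p ‖v z‖ hM0 hp hx
      have h3 : M ≤ 2 * M * b n z := by nlinarith
      linarith
    · have h2 := split m q ‖v z‖ hm0 hq hx
      rw [abs_of_pos hz] at h
      have h3 : m ^ (1 - q) * ‖v z‖ ^ q * 1 ≤ m ^ (1 - q) * ‖v z‖ ^ q * (n * a z) := by gcongr
      have h4 : m ^ (1 - q) * ‖v z‖ ^ q * (n * a z) = m ^ (1 - q) * n * (a z * ‖v z‖ ^ q) := by
        ring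
      linarith
  rw [integral_add I1 I2,
    integral_add (integrable_const m) (hiq.const_mul _),
    integral_add ((hbi n).const_mul _) (hip.const_mul _), integral_const_mul, integral_const_mul,
    integral_const_mul, integral_const, ← Lp.norm_rpow_eq_integral hp0, smul_eq_mul,
    mul_comm (μ.real univ)] at hint
  have hvp : ‖v‖ ^ p ≤ 1 := Real.rpow_le_one ENNReal.toReal_nonneg hv hp0.le
  have h5 : M ^ (1 - p) * ‖v‖ ^ p ≤ M ^ (1 - p) * 1 := by gcongr
  linarith

theorem integrable_norm_rpow_of_memLp {α E : Type*} [MeasurableSpace α] {μ : Measure α}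
    [NormedAddCommGroup E] {σ : ℝ} (hσ : 0 < σ) {v : α → E} (hv : MemLp v (ENNReal.ofReal σ) μ) :
    Integrable (fun z => ‖v z‖ ^ σ) μ := by
  have := hv.integrable_norm_rpow (by simpa using hσ) ENNReal.ofReal_ne_top
  rwa [ENNReal.toReal_ofReal hσ.le] at this

section Mountain

variable {N : ℕ} {Ω : Set (Eucl N)} {p q σ C : ℝ} [Fact (1 ≤ ENNReal.ofReal p)]
  [Fact (1 ≤ ENNReal.ofReal σ)] {a : Eucl N → ℝ} {f : Eucl N → ℝ → ℝ}

/-- Exponent 1 is used because the degenerate weight gives control of the gradient only in `L¹`. -/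
theorem W0.exists_poincare_one (hN : 1 ≤ N) (hb : Bornology.IsBounded Ω) (hp : 1 < p) :
    ∃ C : ℝ, 0 ≤ C ∧ ∀ u : W0 Ω p, ∫ z in Ω, ‖u.fn z‖ ≤ C * ∫ z in Ω, ‖u.grad z‖ := by
  have : IsFiniteMeasure (volume.restrict Ω) := ⟨by simpa using hb.measure_lt_top⟩
  obtain ⟨C, hC⟩ := W0.exists_sobolev hN hb (p := p) le_rfl hp.le (σ := 1) le_rfl
    (by simp)
  refine ⟨C, C.2, fun u => ?_⟩
  have h := hC u
  rw [ENNReal.ofReal_one, eLpNorm_one_eq_lintegral_enorm, eLpNorm_one_eq_lintegral_enorm] at h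
  rw [integral_norm_eq_lintegral_enorm (Lp.aestronglyMeasurable _),
    integral_norm_eq_lintegral_enorm (Lp.aestronglyMeasurable _), ← ENNReal.coe_toReal,
    ← ENNReal.toReal_mul]
  refine ENNReal.toReal_mono (ENNReal.mul_ne_top ENNReal.coe_ne_top ?_) h
  have hi : Integrable u.grad (volume.restrict Ω) :=
    (Lp.memLp u.grad).integrable (Fact.out)
  exact hi.2.ne

/-- An Ehrling-type inequality: the `L^p` norm is controlled, up to a small multiple of the gradient
norm, by the weighted integral `∫ a |Du|^q`. -/
theorem W0.exists_integral_rpow_le (hN : 1 ≤ N) (hb : Bornology.IsBounded Ω)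
    (ha : WeightHyp Ω a) (hq : 1 < q) (hqp : q < p) (hpσ : p < σ) {B : ℝ} (hB : 0 ≤ B)
    (T : W0 Ω p →L[ℝ] Lp ℝ (ENNReal.ofReal σ) (volume.restrict Ω))
    (hT : ∀ u, T u =ᵐ[volume.restrict Ω] u.fn) (hTB : ∀ u, ‖T u‖ ≤ B * ‖u.grad‖)
    {ε : ℝ} (hε : 0 < ε) :
    ∃ K : ℝ, 0 ≤ K ∧ ∀ u : W0 Ω p, ‖u.grad‖ ≤ 1 →
      ∫ z in Ω, ‖u.fn z‖ ^ p ≤ ε + K * ∫ z in Ω, a z * ‖u.grad z‖ ^ q := by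
  have : IsFiniteMeasure (volume.restrict Ω) := ⟨by simpa using hb.measure_lt_top⟩
  have hp : 1 < p := hq.trans hqp
  have hp0 : 0 < p := by linarith
  have hσ0 : 0 < σ := by linarith
  obtain ⟨C₁, hC₁, hP⟩ := W0.exists_poincare_one (p := p) hN hb hp
  -- Λ is the level for interpolating `x^p` between `x` and `x^σ`: the high part is small by the
  -- Sobolev bound in `L^σ`, the low part is controlled in `L¹`.
  obtain ⟨Λ, hΛ0, hΛ⟩ : ∃ Λ : ℝ, 0 < Λ ∧ B ^ σ * Λ ^ (p - σ) < ε / 2 := by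
    have h := (tendsto_rpow_neg_atTop (y := σ - p) (by linarith)).const_mul (B ^ σ)
    rw [mul_zero] at h
    obtain ⟨Λ, h1, h2⟩ := ((h.eventually
      (gt_mem_nhds (by positivity : 0 < ε / 2))).and (eventually_gt_atTop 0)).exists
    exact ⟨Λ, h2, by simpa using h1⟩
  set D : ℝ := Λ ^ (p - 1) * C₁ with hD
  have hD0 : 0 ≤ D := by positivity
  obtain ⟨K, hK, hgrad⟩ := exists_integral_norm_le (p := p) ha hq hqp
    (ε := ε / 2 / (D + 1)) (by positivity)
  refine ⟨D * K, by positivity, fun u hu => ?_⟩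
  set A := ∫ z in Ω, a z * ‖u.grad z‖ ^ q
  have hm := memLp_fn T hT u
  have hiσ := integrable_norm_rpow_of_memLp hσ0 hm
  have hip := integrable_norm_rpow_of_memLp hp0 (Lp.memLp u.fn)
  have hi1 : Integrable (fun z => ‖u.fn z‖) (volume.restrict Ω) :=
    ((Lp.memLp u.fn).integrable (Fact.out)).norm
  have h1 : ∫ z in Ω, ‖u.fn z‖ ^ p ≤
      ∫ z in Ω, (Λ ^ (p - 1) * ‖u.fn z‖ + Λ ^ (p - σ) * ‖u.fn z‖ ^ σ) := by
    refine integral_mono hip ((hi1.const_mul _).add (hiσ.const_mul _)) fun z => ?_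
    set x := ‖u.fn z‖
    have hx : 0 ≤ x := norm_nonneg _
    change x ^ p ≤ Λ ^ (p - 1) * x + Λ ^ (p - σ) * x ^ σ
    have t1 : 0 ≤ Λ ^ (p - 1) * x := by positivity
    have t2 : 0 ≤ Λ ^ (p - σ) * x ^ σ := by positivity
    rcases hx.eq_or_lt with h0 | hx0
    · rw [← h0, Real.zero_rpow hp0.ne', Real.zero_rpow hσ0.ne']
      simp
    rcases le_total x Λ with h | h
    · have e : x ^ p = x ^ (p - 1) * x := by
        rw [← Real.rpow_add_one hx0.ne', sub_add_cancel]
      have : x ^ (p - 1) * x ≤ Λ ^ (p - 1) * x := by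
        gcongr
      linarith
    · have e : x ^ p = x ^ (p - σ) * x ^ σ := by
        rw [← Real.rpow_add hx0, sub_add_cancel]
      have h2 : x ^ (p - σ) ≤ Λ ^ (p - σ) :=
        Real.rpow_le_rpow_of_nonpos hΛ0 h (by linarith)
      have : x ^ (p - σ) * x ^ σ ≤ Λ ^ (p - σ) * x ^ σ := by gcongr
      linarith
  rw [integral_add (hi1.const_mul _) (hiσ.const_mul _), integral_const_mul,
    integral_const_mul] at h1
  have h2 : ∫ z in Ω, ‖u.fn z‖ ^ σ ≤ B ^ σ := by
    have e : ∫ z in Ω, ‖u.fn z‖ ^ σ = ‖T u‖ ^ σ := by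
      rw [Lp.norm_rpow_eq_integral hσ0]
      refine integral_congr_ae ?_
      filter_upwards [hT u] with z hz
      rw [hz]
    rw [e]
    refine Real.rpow_le_rpow (norm_nonneg _) ((hTB u).trans ?_) hσ0.le
    exact mul_le_of_le_one_right hB hu
  have h3 : ∫ z in Ω, ‖u.fn z‖ ≤ C₁ * (ε / 2 / (D + 1) + K * A) :=
    (hP u).trans (mul_le_mul_of_nonneg_left (hgrad u.grad hu) hC₁)
  have h4 : Λ ^ (p - 1) * ∫ z in Ω, ‖u.fn z‖ ≤ D * (ε / 2 / (D + 1)) + D * K * A := by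
    calc _ ≤ Λ ^ (p - 1) * (C₁ * (ε / 2 / (D + 1) + K * A)) := by gcongr
      _ = _ := by rw [hD]; ring
  have h5 : D * (ε / 2 / (D + 1)) ≤ ε / 2 := by
    rw [mul_div_assoc', div_le_iff₀ (by positivity)]
    nlinarith
  have h6 : Λ ^ (p - σ) * ∫ z in Ω, ‖u.fn z‖ ^ σ ≤ Λ ^ (p - σ) * B ^ σ := by gcongr
  linarith

/-- The energy is bounded below by a positive constant on a small sphere. -/
theorem exists_energy_ge_on_sphere (hN : 1 ≤ N) (hb : Bornology.IsBounded Ω)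
    (ha : WeightHyp Ω a) (hq : 1 < q) (hqp : q < p) (hpσ : p < σ) (hC : 0 ≤ C)
    (hf : IsReaction Ω p σ C f) {B : ℝ} (hB : 0 ≤ B)
    (T : W0 Ω p →L[ℝ] Lp ℝ (ENNReal.ofReal σ) (volume.restrict Ω))
    (hT : ∀ u, T u =ᵐ[volume.restrict Ω] u.fn) (hTB : ∀ u, ‖T u‖ ≤ B * ‖u.grad‖) :
    ∃ ρ η : ℝ, 0 < ρ ∧ 0 < η ∧ ∀ u : W0 Ω p, ‖u.grad‖ = ρ → η ≤ energy Ω p q a f u := by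
  have : IsFiniteMeasure (volume.restrict Ω) := ⟨by simpa using hb.measure_lt_top⟩
  have hp : 1 < p := hq.trans hqp
  have hp0 : 0 < p := by linarith
  have hq0 : 0 < q := by linarith
  have hσ0 : 0 < σ := by linarith
  obtain ⟨K, hK, hE⟩ := W0.exists_integral_rpow_le hN hb ha hq hqp hpσ hB T hT hTB
    (ε := 1 / (4 * p * (C + 1))) (by positivity)
  have small : ∀ (X e c : ℝ), 0 < e → 0 < c → ∀ᶠ ρ in 𝓝[>] (0 : ℝ), X * ρ ^ e < c := by
    intro X e c he hc
    have h1 := ((continuous_id.tendsto (0 : ℝ)).rpow_const (p := e) (Or.inr he.le)).const_mul X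
    simp only [id, Real.zero_rpow he.ne', mul_zero] at h1
    exact (h1.mono_left nhdsWithin_le_nhds).eventually (gt_mem_nhds hc)
  -- The `L^σ` term and the ε-term may each cost `ρ^p/(4p)`, which leaves `ρ^p/(2p)`; the second
  -- condition lets the weighted term of the energy absorb the remaining error.
  obtain ⟨ρ, ⟨hρ1, hρ2⟩, hρ0⟩ := (((small (C * B ^ σ) (σ - p) (1 / (4 * p)) (by linarith)
    (by positivity)).and (small (C * K) (p - q) (1 / q) (by linarith) (by positivity))).and
    self_mem_nhdsWithin).exists
  have hρ : 0 < ρ := hρ0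
  refine ⟨ρ, ρ ^ p / (2 * p), hρ, by positivity, fun u hu => ?_⟩
  set w : W0 Ω p := ρ⁻¹ • u with hw
  have huw : u = ρ • w := by rw [hw, smul_inv_smul₀ hρ.ne']
  have hwn : ‖w.grad‖ = 1 := by
    rw [hw, W0.norm_grad_smul (by positivity), hu, inv_mul_cancel₀ hρ.ne']
  have hm := memLp_fn T hT w
  have hmt : MemLp (fun z => ρ * w.fn z) (ENNReal.ofReal σ) (volume.restrict Ω) := hm.const_mul ρ
  have hiσ := integrable_norm_rpow_of_memLp hσ0 hm
  have hip := integrable_norm_rpow_of_memLp hp0 (Lp.memLp w.fn)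
  have hI := hf.isIntegrand hp hpσ hC
  have hF : ∫ z in Ω, primitiveF f z (ρ * w.fn z) ≤
      ∫ z in Ω, (C * ρ ^ p * ‖w.fn z‖ ^ p + C * ρ ^ σ * ‖w.fn z‖ ^ σ) := by
    refine integral_mono_ae (hI.integrable (hp.trans hpσ) hmt)
      ((hip.const_mul _).add (hiσ.const_mul _)) ?_
    filter_upwards [hf.regular] with z hz
    refine (hz.1.primitive_le hp hz.2.1 (hp.trans hpσ) hz.2.2 _).trans (le_of_eq ?_)
    rw [abs_mul, abs_of_pos hρ, Real.mul_rpow hρ.le (abs_nonneg _),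
      Real.mul_rpow hρ.le (abs_nonneg _), Real.norm_eq_abs]
    ring
  rw [integral_add (hip.const_mul _) (hiσ.const_mul _), integral_const_mul,
    integral_const_mul] at hF
  have h2 : ∫ z in Ω, ‖w.fn z‖ ^ σ ≤ B ^ σ := by
    have e : ∫ z in Ω, ‖w.fn z‖ ^ σ = ‖T w‖ ^ σ := by
      rw [Lp.norm_rpow_eq_integral hσ0]
      refine integral_congr_ae ?_
      filter_upwards [hT w] with z hz
      rw [hz]
    rw [e]
    refine Real.rpow_le_rpow (norm_nonneg _) ((hTB w).trans ?_) hσ0.le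
    rw [hwn, mul_one]
  have h3 := hE w hwn.le
  have hA := ha.integral_nonneg (q := q) w
  rw [huw, energy_smul hρ.le, hwn, Real.one_rpow, mul_one]
  set A := ∫ z in Ω, a z * ‖w.grad z‖ ^ q
  have hρp : 0 < ρ ^ p := by positivity
  have e1 : ρ ^ σ = ρ ^ p * ρ ^ (σ - p) := by rw [← Real.rpow_add hρ]; ring_nf
  have e2 : ρ ^ p = ρ ^ q * ρ ^ (p - q) := by rw [← Real.rpow_add hρ]; ring_nf
  have t1 : C * ρ ^ p * ∫ z in Ω, ‖w.fn z‖ ^ p ≤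
      C * ρ ^ p * (1 / (4 * p * (C + 1)) + K * A) := by gcongr
  have t2 : C * ρ ^ σ * ∫ z in Ω, ‖w.fn z‖ ^ σ ≤ C * ρ ^ σ * B ^ σ := by gcongr
  have t3 : C * ρ ^ σ * B ^ σ ≤ ρ ^ p * (1 / (4 * p)) := by
    have : C * ρ ^ σ * B ^ σ = ρ ^ p * (C * B ^ σ * ρ ^ (σ - p)) := by rw [e1]; ring
    rw [this]
    gcongr
  have t4 : C * ρ ^ p * (1 / (4 * p * (C + 1))) ≤ ρ ^ p * (1 / (4 * p)) := by
    have : C * ρ ^ p * (1 / (4 * p * (C + 1))) = ρ ^ p * (1 / (4 * p)) * (C / (C + 1)) := by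
      field_simp
    rw [this]
    exact mul_le_of_le_one_right (by positivity)
      ((div_le_one (by positivity)).2 (by linarith))
  have t5 : C * ρ ^ p * (K * A) ≤ ρ ^ q / q * A := by
    have : C * ρ ^ p * (K * A) = ρ ^ q * (C * K * ρ ^ (p - q)) * A := by rw [e2]; ring
    rw [this, div_eq_mul_one_div]
    gcongr
  have e3 : ρ ^ p / p = ρ ^ p / (2 * p) + ρ ^ p * (1 / (4 * p)) + ρ ^ p * (1 / (4 * p)) := by
    field_simp
    norm_num
  linarith

theorem W0.grad_ne_zero {B : ℝ}
    (T : W0 Ω p →L[ℝ] Lp ℝ (ENNReal.ofReal σ) (volume.restrict Ω))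
    (hT : ∀ u, T u =ᵐ[volume.restrict Ω] u.fn) (hTB : ∀ u, ‖T u‖ ≤ B * ‖u.grad‖)
    {u : W0 Ω p} (hu : u ≠ 0) : u.grad ≠ 0 := by
  intro h
  have h1 : T u = 0 := by
    have := hTB u
    rw [h, norm_zero, mul_zero] at this
    exact norm_le_zero_iff.1 this
  have h2 : u.fn = 0 := by
    refine Lp.ext ?_
    refine (hT u).symm.trans ?_
    rw [h1]
    exact (Lp.coeFn_zero _ _ _).trans (Lp.coeFn_zero _ _ _).symm
  exact hu (Subtype.ext (Prod.ext h2 h))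

/-- There are functions in `W^{1,p}_0(Ω)` which do not vanish almost everywhere. -/
theorem W0.exists_fn_ne_zero (hΩ : IsOpen Ω) (hne : Ω.Nonempty) :
    ∃ u : W0 Ω p, u.fn ≠ 0 := by
  obtain ⟨x, hx⟩ := hne
  obtain ⟨r, hr, hball⟩ := Metric.isOpen_iff.1 hΩ x hx
  let φ : ContDiffBump x := ⟨r / 4, r / 2, by positivity, by linarith⟩
  have hsupp : tsupport φ ⊆ Ω := by
    rw [φ.tsupport_eq]
    exact (Metric.closedBall_subset_ball (by simp [φ]; linarith)).trans hball
  have ht : IsTestFunction Ω φ := ⟨φ.contDiff, φ.hasCompactSupport, hsupp⟩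
  have hg : HasCompactSupport (gradient φ) := by
    refine (φ.hasCompactSupport.fderiv ℝ).comp_left
      (g := (InnerProductSpace.toDual ℝ (Eucl N)).symm) (map_zero _)
  have h1 : MemLp φ (ENNReal.ofReal p) (volume.restrict Ω) :=
    (ht.smooth.continuous.memLp_of_hasCompactSupport φ.hasCompactSupport).restrict Ω
  have h2 : MemLp (gradient φ) (ENNReal.ofReal p) (volume.restrict Ω) :=
    (ht.continuous_gradient.memLp_of_hasCompactSupport hg).restrict Ω
  have hmem : ((h1.toLp, h2.toLp) : LpPair Ω p) ∈ testPairs Ω p :=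
    ⟨φ, ht, h1.coeFn_toLp, h2.coeFn_toLp⟩
  refine ⟨⟨_, Submodule.le_topologicalClosure _ hmem⟩, fun h => ?_⟩
  have h3 : h1.toLp = 0 := h
  have h4 : (φ : Eucl N → ℝ) =ᵐ[volume.restrict Ω] fun _ => 0 := by
    refine h1.coeFn_toLp.symm.trans ?_
    rw [h3]
    exact Lp.coeFn_zero _ _ _
  have h5 := Measure.eqOn_open_of_ae_eq h4 hΩ ht.smooth.continuous.continuousOn
    continuousOn_const hx
  rw [φ.one_of_mem_closedBall (Metric.mem_closedBall_self (by positivity))] at h5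
  exact one_ne_zero h5

end Mountain

/-! ### Descent along rays, and the conclusion -/

theorem exists_energy_smul_nonpos {N : ℕ} {Ω : Set (Eucl N)} {p q σ C : ℝ}
    [Fact (1 ≤ ENNReal.ofReal p)] [Fact (1 ≤ ENNReal.ofReal σ)]
    [IsFiniteMeasure (volume.restrict Ω)] {a : Eucl N → ℝ} {f : Eucl N → ℝ → ℝ}
    (ha : WeightHyp Ω a) (hq : 1 < q) (hqp : q < p) (hpσ : p < σ) (hC : 0 ≤ C)
    (hf : IsReaction Ω p σ C f)
    (T : W0 Ω p →L[ℝ] Lp ℝ (ENNReal.ofReal σ) (volume.restrict Ω))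
    (hT : ∀ u, T u =ᵐ[volume.restrict Ω] u.fn) {u : W0 Ω p} (hu : u.fn ≠ 0) (t₀ : ℝ) :
    ∃ t, 0 < t ∧ t₀ ≤ t ∧ energy Ω p q a f (t • u) ≤ 0 := by
  have hp : 1 < p := hq.trans hqp
  have hp0 : 0 < p := by linarith
  have hq0 : 0 < q := by linarith
  set A := ∫ z in Ω, a z * ‖u.grad z‖ ^ q with hA
  have hA0 : 0 ≤ A := ha.integral_nonneg u
  set D := ‖u.grad‖ ^ p
  have hD0 : 0 ≤ D := Real.rpow_nonneg (norm_nonneg _) _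
  set P := ‖u.fn‖ ^ p with hP
  have hP0 : 0 < P := Real.rpow_pos_of_pos (norm_pos_iff.2 hu) _
  -- Then `M t^p P` cancels both gradient terms for `t ≥ 1` and leaves a surplus `t^p ≥ t`, which
  -- pays for the constant `M R^p V` lost where `|tu| < R`.
  set M := (D / p + A / q + 1) / P with hM
  have hM0 : 0 ≤ M := by positivity
  obtain ⟨R, hR, hsuper⟩ := hf.superlinear M
  set V := (volume.restrict Ω).real univ
  have hV : 0 ≤ V := measureReal_nonneg
  refine ⟨1 + M * R ^ p * V + |t₀|, by positivity, ?_, ?_⟩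
  · have : 0 ≤ M * R ^ p * V := by positivity
    linarith [le_abs_self t₀]
  set t := 1 + M * R ^ p * V + |t₀| with ht
  have hc : 0 ≤ M * R ^ p * V := by positivity
  have ht1 : 1 ≤ t := by linarith [abs_nonneg t₀]
  have ht0 : 0 < t := by linarith
  have hm := memLp_fn T hT u
  have hmt : MemLp (fun z => t * u.fn z) (ENNReal.ofReal σ) (volume.restrict Ω) := hm.const_mul t
  have hip := integrable_norm_rpow_of_memLp hp0 (Lp.memLp u.fn)
  have hF : ∫ z in Ω, (M * t ^ p * ‖u.fn z‖ ^ p - M * R ^ p) ≤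
      ∫ z in Ω, primitiveF f z (t * u.fn z) := by
    refine integral_mono_ae ((hip.const_mul _).sub (integrable_const _))
      ((hf.isIntegrand hp hpσ hC).integrable (hp.trans hpσ) hmt) ?_
    filter_upwards [hf.regular, hsuper] with z hz hs
    have := hz.1.le_primitive hp hz.2.1 hM0 hR hs (t * u.fn z)
    rw [abs_mul, abs_of_pos ht0, Real.mul_rpow ht0.le (abs_nonneg _), ← mul_assoc] at this
    exact this
  rw [integral_sub (hip.const_mul _) (integrable_const _), integral_const_mul, integral_const,
    ← Lp.norm_rpow_eq_integral hp0, ← hP, smul_eq_mul] at hF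
  rw [energy_smul ht0.le]
  have h1 : M * t ^ p * P = t ^ p * (D / p + A / q + 1) := by
    rw [hM]
    field_simp
  have h2 : t ^ q / q * A ≤ t ^ p / q * A := by gcongr
  have h3 : t ≤ t ^ p := by
    simpa using Real.rpow_le_rpow_of_exponent_le ht1 hp.le
  have h4 : t ^ p * (D / p + A / q + 1) = t ^ p / p * D + t ^ p / q * A + t ^ p := by ring
  have h5 : M * R ^ p * V ≤ t := by linarith [abs_nonneg t₀]
  linarith

/-- The infimum `m` of the energy over the Nehari manifold is positive. As the real `sInf` of a set
that is empty or unbounded below is `0`, this contains that the infimum is taken over a nonempty set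
and is finite. The instance argument holds automatically, since `1 < q < p`. -/
theorem proposition5 (N : ℕ) (hN : 1 ≤ N) (Ω : Set (Eucl N)) (hΩ : IsLipschitzDomain Ω)
    (p q r : ℝ) [Fact (1 ≤ ENNReal.ofReal p)] (hq : 1 < q) (hqp : q < p)
    (a : Eucl N → ℝ) (ha : WeightHyp Ω a)
    (f : Eucl N → ℝ → ℝ) (hf : ReactionHyp Ω p q r f) :
    0 < sInf (energy Ω p q a f '' nehari Ω p q a f) := by
  have hb := hΩ.isBounded
  have : IsFiniteMeasure (volume.restrict Ω) := ⟨by simpa using hb.measure_lt_top⟩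
  have hp : 1 < p := hq.trans hqp
  obtain ⟨σ, C, hpσ, hC, hexp, hr⟩ := hf.exists_isReaction hN hp
  have : Fact (1 ≤ ENNReal.ofReal σ) := ⟨by simpa using (hp.trans hpσ).le⟩
  obtain ⟨B, hB⟩ := W0.exists_sobolev hN hb (p := p) hp.le le_rfl (hp.trans hpσ).le hexp
  obtain ⟨T, hT, hTB⟩ := W0.exists_embedding hB
  obtain ⟨ρ, η, hρ, hη, hsphere⟩ :=
    exists_energy_ge_on_sphere hN hb ha hq hqp hpσ hC hr B.2 T hT hTB
  have hray : ∀ u : W0 Ω p, u.grad ≠ 0 → 0 < ρ / ‖u.grad‖ ∧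
      η ≤ energy Ω p q a f ((ρ / ‖u.grad‖) • u) := by
    intro u hu
    have h0 : 0 < ‖u.grad‖ := norm_pos_iff.2 hu
    refine ⟨by positivity, hsphere _ ?_⟩
    rw [W0.norm_grad_smul (by positivity), div_mul_cancel₀ _ h0.ne']
  have hlow : ∀ u ∈ nehari Ω p q a f, η ≤ energy Ω p q a f u := by
    rintro u ⟨hu, hu0⟩
    have h := hray u (W0.grad_ne_zero T hT hTB hu0)
    exact h.2.trans (energy_smul_le hq hqp hpσ hC ha hr T hT hu h.1.le)
  have hne : (nehari Ω p q a f).Nonempty := by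
    obtain ⟨u, hu⟩ := W0.exists_fn_ne_zero (p := p) hΩ.isOpen hΩ.isConnected.nonempty
    have hu0 : u ≠ 0 := by
      rintro rfl
      exact hu rfl
    obtain ⟨ht₀, hη₀⟩ := hray u (W0.grad_ne_zero T hT hTB hu0)
    set t₀ := ρ / ‖u.grad‖
    obtain ⟨t₁, -, ht₀₁, hneg⟩ :=
      exists_energy_smul_nonpos ha hq hqp hpσ hC hr T hT hu t₀
    set g : ℝ → ℝ := fun t => energy Ω p q a f (t • u) with hg
    have hd : ∀ t, ∃ L : W0 Ω p →L[ℝ] ℝ, HasFDerivAt (energy Ω p q a f) L (t • u) ∧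
        HasDerivAt g (L u) t := by
      intro t
      obtain ⟨L, hL, -⟩ := exists_hasFDerivAt_energy hq hqp hpσ hC ha hr T hT (t • u)
      have h1 : HasDerivAt (fun t : ℝ => t • u) u t := by
        simpa using (hasDerivAt_id t).smul_const u
      have h2 := HasFDerivAt.comp_hasDerivAt (f := fun t : ℝ => t • u) t hL h1
      exact ⟨L, hL, h2⟩
    have hgc : Continuous g := continuous_iff_continuousAt.2 fun t =>
      (hd t).choose_spec.2.continuousAt
    -- The maximum over `[0,t₁]` is at least η, while the energy is 0 at `t = 0` and at most 0 at
    -- `t₁`; hence it is interior and the derivative along the ray vanishes there.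
    obtain ⟨s, hs, hmax⟩ := isCompact_Icc.exists_isMaxOn (nonempty_Icc.2 (ht₀.le.trans ht₀₁))
      hgc.continuousOn
    have hgs : η ≤ g s := hη₀.trans (hmax ⟨ht₀.le, ht₀₁⟩)
    have hs0 : s ≠ 0 := by
      rintro rfl
      have : g 0 = 0 := by
        simp only [hg]
        rw [energy_smul le_rfl, Real.zero_rpow (by linarith), Real.zero_rpow (by linarith)]
        simp [primitiveF]
      linarith
    have hs1 : s ≠ t₁ := by
      rintro rfl
      have : g s ≤ 0 := hneg
      linarith
    have hloc : IsLocalMax g s := hmax.isLocalMax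
      (Icc_mem_nhds (lt_of_le_of_ne hs.1 hs0.symm) (lt_of_le_of_ne hs.2 hs1))
    obtain ⟨L, hL, hLd⟩ := hd s
    refine ⟨s • u, ?_, smul_ne_zero hs0 hu0⟩
    rw [hL.fderiv, map_smul, hloc.hasDerivAt_eq_zero hLd, smul_zero]
  refine hη.trans_le (le_csInf (hne.image _) ?_)
  rintro _ ⟨u, hu, rfl⟩
  exact hlow u hu
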